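/- Consider a horizontal uniform rectangular array (HURA) with $M=M_xM_y$ antennas and spacings $d_x,d_y$, whose steering vector is $\mathbf a(\phi,\theta)=\mathbf a_x(\phi,\theta)\otimes\mathbf a_y(\phi,\theta)$, with $(\mathbf a_x)_m=e^{j2\pi d_x(m-1)\sin\theta\cos\phi}$ for $1\le m\le M_x$ and $(\mathbf a_y)_m=e^{j2\pi d_y(m-1)\sin\theta\sin\phi}$ for $1\le m\le M_y$. Consider two rays of a common cluster, with azimuths $\phi_i=\phi_c+\Delta_i$ and elevations $\theta_i=\theta_c+\delta_i$, $i=1,2$, where the real random variables $\phi_c,\theta_c,\Delta_1,\Delta_2,\delta_1,\delta_2$ are independent, $\Delta_1,\Delta_2$ are identically distributed, and $\delta_1,\delta_2$ are identically distributed with a probability density. Put $$K_s=\frac1{M^2}\,\mathbb E\big[|\mathbf a^{\mathrm H}(\phi_1,\theta_1)\,\mathbf a(\phi_2,\theta_2)|^2\big],$$ and let $K_s^{[0,\pi]}$ be the same average restricted to elevations in $[0,\pi]$, that is, with the integrand multiplied by the indicator of the event that $\theta_1$ and $\theta_2$ both lie in $[0,\pi]$ modulo $2\pi$. For integers $n$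 let $\chi_c^{\rm az}(n)=\mathbb E[e^{jn\phi_c}]$, $\chi_s^{\rm az}(n)=\mathbb E[e^{jn\Delta_1}]$, $\chi_c^{\rm el}(n)=\mathbb E[e^{jn\theta_c}]$, $\chi_s^{\rm el}(n)=\mathbb E[e^{jn\delta_1}]$. For $0\le m_x,m_x'\le M_x-1$ and $0\le m_y,m_y'\le M_y-1$ let $z_1=d_x(m_x-m_x')$, $z_2=d_y(m_y-m_y')$, $z_T=2\pi\sqrt{z_1^2+z_2^2}$, and let $\alpha=\tan^{-1}(z_1/z_2)$ be the four-quadrant inverse tangent (the argument of $z_2+jz_1$). Let $\rho(x)=\min(x,0)$, let $J_\nu$ be the Bessel function of the first kind, and let $$\zeta_s(n,n',k,k',z)=e^{-j\frac{\pi}{2}(k+k')}\,J_{\frac{|n|}2-\frac k2}\!\left(-\tfrac z2\right)J_{\frac{|n|}2+\frac k2}\!\left(-\tfrac z2\right)(-1)^{\rho(n)+\rho(n')}\,J_{\frac{|n'|}2-\frac{k'}2}\!\left(\tfrac z2\right)J_{\frac{|n'|}2+\frac{k'}2}\!\left(\tfrac z2\right),$$ where each product $J_{|n|/2-k/2}(x)J_{|n|/2+k/2}(x)$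 is the entire function of $x$ so denoted (at $x=0$ it is given by continuity). Then $$K_s^{[0,\pi]}=\frac1{4M^2}\sum_{m_x,m_x'=0}^{M_x-1}\ \sum_{m_y,m_y'=0}^{M_y-1}\ \sum_{n=-\infty}^{\infty}\sum_{n'=-\infty}^{\infty}\sum_{k=-\infty}^{\infty}\sum_{k'=-\infty}^{\infty}\chi_c^{\rm az}(n+n')\chi_s^{\rm az}(n)\chi_s^{\rm az}(n')\,\chi_c^{\rm el}(k+k')\chi_s^{\rm el}(k)\chi_s^{\rm el}(k')\,e^{j(n+n')\alpha}\,\zeta_s(n,n',k,k',z_T).$$ Here the sums over $k'$ and $k$ are iterated limits of symmetric partial sums, and the double series over $(n,n')$ converges unconditionally. In particular, if $\theta_1,\theta_2\in[0,\pi]$ almost surely, then $K_s$ itself equals the right-hand side. -/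

import Mathlib

open MeasureTheory ProbabilityTheory

noncomputable section

/-! ### Bessel functions of the first kind -/

/-- The power-series factor of the Bessel function:
`∑ₘ (-1)ᵐ / (m! Γ(m + ν + 1)) (z/2)²ᵐ`, an entire function of `z` for every real order `ν`
(`1/Γ` is zero at the poles of `Γ`, which is also Mathlib's convention). -/
def besselSeries (ν : ℝ) (z : ℂ) : ℂ :=
  ∑' m : ℕ, (-1) ^ m / ((m.factorial : ℂ) * Complex.Gamma ((m : ℂ) + (ν : ℂ) + 1)) *
    (z / 2) ^ (2 * m)

/-- The Bessel function of the first kind `J_ν(z)` of real order `ν`, on the principal branch. -/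
def besselJ (ν : ℝ) (z : ℂ) : ℂ :=
  (z / 2) ^ (ν : ℂ) * besselSeries ν z

/-- The product `J_{|n|/2 - k/2}(x) J_{|n|/2 + k/2}(x)` as an entire function of `x`: the powers
`(x/2)^{|n|/2 - k/2}` and `(x/2)^{|n|/2 + k/2}` multiply to `(x/2)^{|n|}`, so that the product is
also defined at `x = 0`, where one of the two factors may be singular. -/
def besselPair (n k : ℤ) (x : ℂ) : ℂ :=
  (x / 2) ^ n.natAbs *
    (besselSeries ((n.natAbs : ℝ) / 2 - (k : ℝ) / 2) x *
      besselSeries ((n.natAbs : ℝ) / 2 + (k : ℝ) / 2) x)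

/-- Away from `x = 0` the function `besselPair` is literally the product of Bessel functions. -/
theorem besselPair_eq (n k : ℤ) {x : ℂ} (hx : x ≠ 0) :
    besselPair n k x =
      besselJ ((n.natAbs : ℝ) / 2 - (k : ℝ) / 2) x *
        besselJ ((n.natAbs : ℝ) / 2 + (k : ℝ) / 2) x := by
  have h2 : x / 2 ≠ 0 := div_ne_zero hx two_ne_zero
  have h : (x / 2) ^ n.natAbs =
      (x / 2) ^ (((n.natAbs : ℝ) / 2 - (k : ℝ) / 2 : ℝ) : ℂ) *
        (x / 2) ^ (((n.natAbs : ℝ) / 2 + (k : ℝ) / 2 : ℝ) : ℂ) := by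
    rw [← Complex.cpow_add _ _ h2, ← Complex.cpow_natCast]
    congr 1
    push_cast
    ring
  unfold besselPair besselJ
  rw [h]
  ring

/-- The series factor as a regularized hypergeometric function. -/
theorem besselSeries_eq (ν : ℝ) (z : ℂ) :
    besselSeries ν z = Complex.regularizedHGFun 0 {(ν : ℂ) + 1} (-(z / 2) ^ 2) := by
  unfold besselSeries Complex.regularizedHGFun FormalMultilinearSeries.sum
  refine tsum_congr fun m => ?_
  rw [FormalMultilinearSeries.apply_eq_pow_smul_coeff, Complex.regularizedHGFunSeries_coeff]
  simp only [Complex.regularizedHGFunCoeff, smul_eq_mul, Multiset.map_zero, Multiset.prod_zero,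
    Multiset.map_singleton, Multiset.prod_singleton]
  rw [show (m : ℂ) + ν + 1 = (ν : ℂ) + 1 + m by ring, neg_pow ((z / 2) ^ 2), ← pow_mul]
  ring

theorem continuous_besselSeries (ν : ℝ) : Continuous (besselSeries ν) := by
  have hr : (Complex.regularizedHGFunSeries 0 {(ν : ℂ) + 1}).radius = ⊤ :=
    Complex.radius_regularizedHGFunSeries_eq_top (by simp)
  have hc : Continuous (Complex.regularizedHGFun 0 {(ν : ℂ) + 1}) := by
    have h := (Complex.regularizedHGFunSeries 0 {(ν : ℂ) + 1}).continuousOn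
    rw [hr, Metric.eball_top] at h
    exact continuousOn_univ.mp h
  have he : besselSeries ν =
      fun z => Complex.regularizedHGFun 0 {(ν : ℂ) + 1} (-(z / 2) ^ 2) :=
    funext (besselSeries_eq ν)
  rw [he]
  exact hc.comp (by fun_prop)

/-- At `x = 0`, `besselPair` is the continuous extension of the product of Bessel functions. -/
theorem continuous_besselPair (n k : ℤ) : Continuous (besselPair n k) := by
  unfold besselPair
  exact Continuous.mul (by fun_prop)
    ((continuous_besselSeries _).mul (continuous_besselSeries _))

/-! ### The horizontal uniform rectangular array and the metric `K_s` -/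

/-- Entries of the steering vector along the `x`-axis (antenna index starting at `0`). -/
def steerX (Mx : ℕ) (dx φ θ : ℝ) (m : Fin Mx) : ℂ :=
  Complex.exp (Complex.I * (2 * Real.pi * dx * (m : ℕ) * Real.sin θ * Real.cos φ))

/-- Entries of the steering vector along the `y`-axis (antenna index starting at `0`). -/
def steerY (My : ℕ) (dy φ θ : ℝ) (m : Fin My) : ℂ :=
  Complex.exp (Complex.I * (2 * Real.pi * dy * (m : ℕ) * Real.sin θ * Real.sin φ))

/-- Steering vector of the array: the Kronecker product of the two axis vectors. -/
def steer (Mx My : ℕ) (dx dy φ θ : ℝ) (p : Fin Mx × Fin My) : ℂ :=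
  steerX Mx dx φ θ p.1 * steerY My dy φ θ p.2

/-- `|aᴴ(φ, θ) a(φ', θ')|²` for two rays with angles `(φ, θ)` and `(φ', θ')`. -/
def rayCorr (Mx My : ℕ) (dx dy φ θ φ' θ' : ℝ) : ℝ :=
  ‖star (steer Mx My dx dy φ θ) ⬝ᵥ steer Mx My dx dy φ' θ'‖ ^ 2

variable {Ω : Type*} [MeasurableSpace Ω]

/-- `K_s = M⁻² E[|aᴴ(φ₁, θ₁) a(φ₂, θ₂)|²]`, `M = Mx My`, for two rays of a common cluster:
`φᵢ = φc + Δᵢ` and `θᵢ = θc + δᵢ`. -/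
def Ks (P : Measure Ω) (Mx My : ℕ) (dx dy : ℝ) (φc θc Δ₁ Δ₂ δ₁ δ₂ : Ω → ℝ) : ℝ :=
  1 / ((Mx : ℝ) * My) ^ 2 *
    ∫ ω, rayCorr Mx My dx dy (φc ω + Δ₁ ω) (θc ω + δ₁ ω) (φc ω + Δ₂ ω) (θc ω + δ₂ ω) ∂P

/-- The angles that lie in `[0, π]` modulo `2π`. -/
def elevationWindow : Set ℝ :=
  {x | ∃ j : ℤ, x - 2 * Real.pi * j ∈ Set.Icc 0 Real.pi}

/-- `K_s` with the average over the elevation angles of both rays restricted to `[0, π]`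
(angles being taken modulo `2π`). -/
def KsWindow (P : Measure Ω) (Mx My : ℕ) (dx dy : ℝ) (φc θc Δ₁ Δ₂ δ₁ δ₂ : Ω → ℝ) : ℝ :=
  1 / ((Mx : ℝ) * My) ^ 2 *
    ∫ ω in {ω | θc ω + δ₁ ω ∈ elevationWindow ∧ θc ω + δ₂ ω ∈ elevationWindow},
      rayCorr Mx My dx dy (φc ω + Δ₁ ω) (θc ω + δ₁ ω) (φc ω + Δ₂ ω) (θc ω + δ₂ ω) ∂P

/-! ### The fourfold series -/

/-- Characteristic function `χ(n) = E[e^{jnX}]` of an angle `X` at an integer `n`. -/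
def angleChar (P : Measure Ω) (X : Ω → ℝ) (n : ℤ) : ℂ :=
  ∫ ω, Complex.exp (Complex.I * (n * X ω)) ∂P

/-- `z_T = 2π √(z₁² + z₂²)`. -/
def zT (z₁ z₂ : ℝ) : ℝ := 2 * Real.pi * Real.sqrt (z₁ ^ 2 + z₂ ^ 2)

/-- `α = tan⁻¹(z₁ / z₂)`, the four-quadrant inverse tangent: the argument of `z₂ + j z₁`. -/
def phaseAngle (z₁ z₂ : ℝ) : ℝ := Complex.arg ⟨z₂, z₁⟩

/-- `ζ_s(n, n', k, k', z)`. -/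
def zetaS (n n' k k' : ℤ) (z : ℝ) : ℂ :=
  Complex.exp (-(Complex.I * (Real.pi / 2) * (k + k'))) *
    besselPair n k (-((z : ℂ) / 2)) *
    ((-1) ^ (min n 0 + min n' 0) * besselPair n' k' ((z : ℂ) / 2))

/-- The summand of the fourfold series for the antenna differences `z₁`, `z₂`. -/
def ksTerm (P : Measure Ω) (φc θc Δ δ : Ω → ℝ) (z₁ z₂ : ℝ) (n n' k k' : ℤ) : ℂ :=
  angleChar P φc (n + n') * angleChar P Δ n * angleChar P Δ n' *
    angleChar P θc (k + k') * angleChar P δ k * angleChar P δ k' *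
    Complex.exp (Complex.I * ((n + n') * phaseAngle z₁ z₂)) *
    zetaS n n' k k' (zT z₁ z₂)

/-- `∑ₙ ∑ₙ' ∑ₖ ∑ₖ' T n n' k k' = s` as an iterated series: the sums over `k'` and over `k` are
limits of symmetric partial sums (as for Fourier series), and the double sum over `(n, n')`
converges unconditionally. -/
def HasFourfoldSum (T : ℤ → ℤ → ℤ → ℤ → ℂ) (s : ℂ) : Prop :=
  ∃ (u : ℤ → ℤ → ℂ) (v : ℤ → ℤ → ℤ → ℂ),
    (∀ n n' k, HasSum (fun k' => T n n' k k') (v n n' k) (SummationFilter.symmetricIcc ℤ)) ∧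
    (∀ n n', HasSum (fun k => v n n' k) (u n n') (SummationFilter.symmetricIcc ℤ)) ∧
    HasSum (fun q : ℤ × ℤ => u q.1 q.2) s

end

/-!
For one antenna pair, with differences `z₁ = dx (mx - mx')` and `z₂ = dy (my - my')`, the identity
`2π (z₁ cos φ + z₂ sin φ) = zT sin (φ + α)` turns the contribution of the pair to `|aᴴ a'|²` into
`e^{-j zT sin θ₁ sin (φ₁ + α)} e^{j zT sin θ₂ sin (φ₂ + α)}`. The Jacobi-Anger expansion
(`hasSum_jacobiAnger`) separates azimuth from elevation: `e^{jx sin ψ} = ∑ₙ Jₙ(x) e^{jnψ}`, with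
`Jₙ = (-1)^{min n 0} J_{|n|}`. What remains in the elevation is the windowed Bessel function
`1_{sin θ ≥ 0} J_{|n|}(r sin θ)`, and by Lommel's integral (`integral_besselInt_mul_exp`) its `k`-th
Fourier coefficient is `½ e^{-jπk/2} J_{|n|/2 - k/2}(r/2) J_{|n|/2 + k/2}(r/2)`. The two factors `½`
are the `1/4` of the formula. By independence a term of the fourfold series is therefore, up to the
factor `4`, the expectation of one Jacobi-Anger term with one Fourier mode for each ray
(`ksTerm_eq_integral`), and it remains to exchange sums and expectations.

* Sums over `k` and `k'`: the windowed functions are Lipschitz functions plus a multiple of a square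
  wave, so that the symmetric partial sums of their Fourier series are uniformly bounded and
  converge off the edges `sin θ = 0` (`exists_norm_circlePartialSum_besselWindow_le`,
  `tendsto_circlePartialSum_besselWindow`). Both follow from Chernoff's telescoping identity
  `circlePartialSum_sub`, except for the bound for the square wave, which is a summation by parts.
  The edges have probability zero, since `δ₁` and `δ₂` have densities; hence dominated convergence
  applies (`hasSum_integral_besselWindow`).
* Sum over `(n, n')`: `|J_{|n|}(x)| ≤ (R/2)^{|n|} / |n|! · e^{R²/4}` for `|x| ≤ R` gives absolute
  convergence (`hasSum_integral_windowWave`).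
-/

/-! ### Products of Bessel series -/

theorem hasSum_of_forall_eq {ι E : Type*} [AddCommMonoid E] [TopologicalSpace E] {f g : ι → E}
    {a : E} {L : SummationFilter ι} (h : ∀ i, f i = g i) (hg : HasSum g a L) : HasSum f a L := by
  rwa [funext h]

theorem summable_norm_besselSeries (ν : ℝ) (z : ℂ) :
    Summable fun m : ℕ => ‖(-1) ^ m / ((m.factorial : ℂ) * Complex.Gamma ((m : ℂ) + (ν : ℂ) + 1)) *
      (z / 2) ^ (2 * m)‖ := by
  have hr : (Complex.regularizedHGFunSeries 0 {(ν : ℂ) + 1}).radius = ⊤ :=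
    Complex.radius_regularizedHGFunSeries_eq_top (by simp)
  have h := (Complex.regularizedHGFunSeries 0 {(ν : ℂ) + 1}).summable_norm_apply
    (x := -(z / 2) ^ 2) (by rw [hr, Metric.eball_top]; trivial)
  refine h.congr fun m => ?_
  rw [FormalMultilinearSeries.apply_eq_pow_smul_coeff, Complex.regularizedHGFunSeries_coeff]
  simp only [Complex.regularizedHGFunCoeff, smul_eq_mul, Multiset.map_zero, Multiset.prod_zero,
    Multiset.map_singleton, Multiset.prod_singleton]
  rw [show (m : ℂ) + ν + 1 = (ν : ℂ) + 1 + m by ring, neg_pow ((z / 2) ^ 2), ← pow_mul]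
  congr 1
  ring

/-- The recurrence of `1 / Γ`, iterated; it holds at the poles of `Γ` too, where `Γ⁻¹ = 0`. -/
theorem inv_Gamma_sub_nat (a : ℂ) (j : ℕ) :
    (Complex.Gamma (a - j + 1))⁻¹ =
      (descPochhammer ℤ j).smeval a * (Complex.Gamma (a + 1))⁻¹ := by
  induction j with
  | zero => simp
  | succ j ih =>
    rw [descPochhammer_succ_right, Polynomial.smeval_mul, Polynomial.smeval_sub,
      Polynomial.smeval_X, Polynomial.smeval_natCast,
      Complex.one_div_Gamma_eq_self_mul_one_div_Gamma_add_one,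
      show a - ((j + 1 : ℕ) : ℂ) + 1 + 1 = a - j + 1 by push_cast; ring, ih]
    push_cast
    simp
    ring

/-- The coefficients of a product of two Bessel series: the Chu-Vandermonde identity for reciprocal
Gamma factors, valid also at the poles of `Γ`. -/
theorem sum_antidiagonal_inv_Gamma (μ ν : ℂ) (N m : ℕ) (h : μ + ν = N) :
    ∑ p ∈ Finset.HasAntidiagonal.antidiagonal m,
      (((p.1.factorial : ℂ) * Complex.Gamma (p.1 + μ + 1))⁻¹ *
        ((p.2.factorial : ℂ) * Complex.Gamma (p.2 + ν + 1))⁻¹) =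
      ((2 * m + N).factorial : ℂ) * ((m.factorial : ℂ) * (m + N).factorial)⁻¹ *
        ((Complex.Gamma (m + μ + 1))⁻¹ * (Complex.Gamma (m + ν + 1))⁻¹) := by
  have hV := Ring.descPochhammer_smeval_add (r := (m : ℂ) + ν) (s := (m : ℂ) + μ) m
    (Commute.all _ _)
  rw [show (m : ℂ) + ν + (m + μ) = ((2 * m + N : ℕ) : ℂ) by push_cast; rw [← h]; ring,
    Polynomial.descPochhammer_smeval_eq_descFactorial] at hV
  have hD : ((2 * m + N).descFactorial m : ℂ) * (m + N).factorial = (2 * m + N).factorial := by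
    rw [← Nat.factorial_mul_descFactorial (show m ≤ 2 * m + N by omega),
      show 2 * m + N - m = m + N by omega]
    push_cast; ring
  have hfm : (m.factorial : ℂ) ≠ 0 := by exact_mod_cast m.factorial_ne_zero
  have hfN : ((m + N).factorial : ℂ) ≠ 0 := by exact_mod_cast (m + N).factorial_ne_zero
  rw [← hD, hV, mul_inv, show ∀ a b c d : ℂ, a * b * (c * b⁻¹) * d = (b * b⁻¹) * (c * d) * a by
    intros; ring, mul_inv_cancel₀ hfN, one_mul, Finset.mul_sum]
  refine Finset.sum_congr rfl fun p hp => ?_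
  rw [Finset.HasAntidiagonal.mem_antidiagonal] at hp
  have hpm : (p.1 : ℂ) + p.2 = m := by exact_mod_cast congrArg (Nat.cast (R := ℂ)) hp
  have h1 := inv_Gamma_sub_nat (m + μ) p.2
  have h2 := inv_Gamma_sub_nat (m + ν) p.1
  rw [show (m : ℂ) + μ - p.2 + 1 = p.1 + μ + 1 by rw [← hpm]; ring] at h1
  rw [show (m : ℂ) + ν - p.1 + 1 = p.2 + ν + 1 by rw [← hpm]; ring] at h2
  have hc : (m.choose p.1 : ℂ) * p.1.factorial * p.2.factorial = m.factorial := by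
    have := Nat.choose_mul_factorial_mul_factorial (show p.1 ≤ m by omega)
    rw [show m - p.1 = p.2 by omega] at this
    exact_mod_cast this
  have hf1 : (p.1.factorial : ℂ) ≠ 0 := by exact_mod_cast p.1.factorial_ne_zero
  have hf2 : (p.2.factorial : ℂ) ≠ 0 := by exact_mod_cast p.2.factorial_ne_zero
  rw [mul_inv, mul_inv, h1, h2, ← hc]
  have hc0 : (m.choose p.1 : ℂ) ≠ 0 := by
    intro h0; rw [h0] at hc; simp at hc; exact hfm hc.symm
  field_simp

/-- The power series of a product of Bessel functions whose orders add up to `|n|`. -/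
theorem hasSum_besselPair (n k : ℤ) (x : ℂ) :
    HasSum (fun m : ℕ => (-1) ^ m * ((2 * m + n.natAbs).factorial : ℂ) *
        ((m.factorial : ℂ) * (m + n.natAbs).factorial)⁻¹ *
        ((Complex.Gamma (m + ((n.natAbs : ℂ) - k) / 2 + 1))⁻¹ *
          (Complex.Gamma (m + ((n.natAbs : ℂ) + k) / 2 + 1))⁻¹) *
        (x / 2) ^ (2 * m + n.natAbs)) (besselPair n k x) := by
  set N := n.natAbs
  have h1 := summable_norm_besselSeries ((N : ℝ) / 2 - (k : ℝ) / 2) x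
  have h2 := summable_norm_besselSeries ((N : ℝ) / 2 + (k : ℝ) / 2) x
  have hs := (summable_norm_sum_mul_antidiagonal_of_summable_norm h1 h2).of_norm.hasSum
  rw [← tsum_mul_tsum_eq_tsum_sum_antidiagonal_of_summable_norm h1 h2] at hs
  have hs' := hs.mul_left ((x / 2) ^ N)
  have hv : besselPair n k x = (x / 2) ^ N *
      ((∑' m : ℕ, (-1) ^ m / ((m.factorial : ℂ) *
          Complex.Gamma ((m : ℂ) + (((N : ℝ) / 2 - (k : ℝ) / 2 : ℝ) : ℂ) + 1)) *
          (x / 2) ^ (2 * m)) *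
        ∑' m : ℕ, (-1) ^ m / ((m.factorial : ℂ) *
          Complex.Gamma ((m : ℂ) + (((N : ℝ) / 2 + (k : ℝ) / 2 : ℝ) : ℂ) + 1)) *
          (x / 2) ^ (2 * m)) := rfl
  rw [hv]
  refine hasSum_of_forall_eq (fun m => ?_) hs'
  have hV := sum_antidiagonal_inv_Gamma (((N : ℂ) - k) / 2) (((N : ℂ) + k) / 2) N m (by ring)
  rw [mul_assoc ((-1) ^ m) _ _, mul_assoc ((-1) ^ m) _ _, ← hV, pow_add, Finset.mul_sum,
    Finset.mul_sum, Finset.sum_mul]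
  refine Finset.sum_congr rfl fun p hp => ?_
  rw [Finset.HasAntidiagonal.mem_antidiagonal] at hp
  rw [show (((N : ℝ) / 2 - (k : ℝ) / 2 : ℝ) : ℂ) = ((N : ℂ) - k) / 2 by push_cast; ring,
    show (((N : ℝ) / 2 + (k : ℝ) / 2 : ℝ) : ℂ) = ((N : ℂ) + k) / 2 by push_cast; ring,
    ← hp, mul_add, pow_add, pow_add]
  ring

/-! ### Fourier coefficients of powers of the sine on the half circle -/

/-- The reflection formula turns the reciprocal Gamma factors into `sin (πk/2) / (πk/2)`. -/
theorem integral_sin_pow_mul_exp_base (k : ℤ) :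
    ∫ t in (0 : ℝ)..Real.pi, Complex.exp (-(Complex.I * (k * t))) =
      Real.pi * Complex.exp (-(Complex.I * (Real.pi / 2) * k)) *
        ((Complex.Gamma (1 + k / 2))⁻¹ * (Complex.Gamma (1 - k / 2))⁻¹) := by
  rcases eq_or_ne k 0 with rfl | hk
  · simp
  have hk' : (k : ℂ) ≠ 0 := by exact_mod_cast hk
  have hpi : (Real.pi : ℂ) ≠ 0 := by exact_mod_cast Real.pi_ne_zero
  have hint : ∫ t in (0 : ℝ)..Real.pi, Complex.exp (-(Complex.I * (k * t))) =
      (Complex.exp (-(Complex.I * k) * Real.pi) - 1) / (-(Complex.I * k)) := by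
    have := integral_exp_mul_complex (a := 0) (b := Real.pi) (c := -(Complex.I * k))
      (neg_ne_zero.2 (mul_ne_zero Complex.I_ne_zero hk'))
    simp only [Complex.ofReal_zero, mul_zero, Complex.exp_zero] at this
    rw [← this]
    refine intervalIntegral.integral_congr fun t _ => ?_
    congr 1
    ring
  have hG : (Complex.Gamma (1 + k / 2))⁻¹ * (Complex.Gamma (1 - k / 2))⁻¹ =
      Complex.sin (Real.pi * (k / 2)) / (Real.pi * (k / 2)) := by
    have h := Complex.Gamma_mul_Gamma_one_sub ((k : ℂ) / 2)
    rw [add_comm (1 : ℂ), Complex.Gamma_add_one _ (div_ne_zero hk' two_ne_zero), ← mul_inv,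
      mul_assoc, h]
    field_simp
  have hs : Complex.sin (Real.pi * (k / 2)) =
      (Complex.exp (-(Complex.I * (Real.pi / 2) * k)) -
        Complex.exp (Complex.I * (Real.pi / 2) * k)) * Complex.I / 2 := by
    rw [Complex.sin]
    congr 3 <;> congr 1 <;> ring
  rw [hint, hG, hs]
  have h1 : Complex.exp (-(Complex.I * k) * Real.pi) =
      Complex.exp (-(Complex.I * (Real.pi / 2) * k)) *
        Complex.exp (-(Complex.I * (Real.pi / 2) * k)) := by
    rw [← Complex.exp_add]; congr 1; ring
  have h2 : Complex.exp (-(Complex.I * (Real.pi / 2) * k)) *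
        Complex.exp (Complex.I * (Real.pi / 2) * k) = 1 := by
    rw [← Complex.exp_add]; simp
  rw [h1]
  rw [show ∀ a b : ℂ, (Real.pi : ℂ) * a * ((a - b) * Complex.I / 2 / (Real.pi * (k / 2))) =
    (a * a - a * b) * (Complex.I / k) * (Real.pi / Real.pi) by intros; field_simp, h2,
    div_self hpi, mul_one]
  field_simp
  rw [Complex.I_sq]
  ring

/-- The half-circle Fourier coefficients of `sin ^ p`, by induction on `p`: multiplication by
`sin t = (e^{it} - e^{-it}) / 2i` becomes the recurrence of `1 / Γ`. -/
theorem integral_sin_pow_mul_exp (p : ℕ) (k : ℤ) :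
    ∫ t in (0 : ℝ)..Real.pi, (Real.sin t : ℂ) ^ p * Complex.exp (-(Complex.I * (k * t))) =
      Real.pi * Complex.exp (-(Complex.I * (Real.pi / 2) * k)) * (p.factorial / 2 ^ p) *
        ((Complex.Gamma (1 + (p + k) / 2))⁻¹ * (Complex.Gamma (1 + (p - k) / 2))⁻¹) := by
  induction p generalizing k with
  | zero =>
    have := integral_sin_pow_mul_exp_base k
    simp only [pow_zero, one_mul, Nat.factorial_zero, Nat.cast_one, div_one, mul_one,
      Nat.cast_zero, zero_add, zero_sub, neg_div, ← sub_eq_add_neg]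
    exact this
  | succ p ih =>
    have hsplit : ∀ t : ℝ, (Real.sin t : ℂ) ^ (p + 1) * Complex.exp (-(Complex.I * (k * t))) =
        (Complex.I / 2) * ((Real.sin t : ℂ) ^ p *
          Complex.exp (-(Complex.I * (((k + 1 : ℤ) : ℂ) * t))) -
        (Real.sin t : ℂ) ^ p * Complex.exp (-(Complex.I * (((k - 1 : ℤ) : ℂ) * t)))) := by
      intro t
      have e1 : Complex.exp (-(Complex.I * (((k + 1 : ℤ) : ℂ) * t))) =
          Complex.exp (-(Complex.I * (k * t))) * Complex.exp (-t * Complex.I) := by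
        rw [← Complex.exp_add]; congr 1; push_cast; ring
      have e2 : Complex.exp (-(Complex.I * (((k - 1 : ℤ) : ℂ) * t))) =
          Complex.exp (-(Complex.I * (k * t))) * Complex.exp (t * Complex.I) := by
        rw [← Complex.exp_add]; congr 1; push_cast; ring
      have e3 : (Real.sin t : ℂ) =
          (Complex.exp (-t * Complex.I) - Complex.exp (t * Complex.I)) * Complex.I / 2 := by
        rw [Complex.ofReal_sin, Complex.sin]
      rw [e1, e2, pow_succ]
      nth_rewrite 2 [e3]
      ring
    have hc : ∀ l : ℤ, IntervalIntegrable (fun t : ℝ => (Real.sin t : ℂ) ^ p *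
        Complex.exp (-(Complex.I * ((l : ℂ) * t)))) volume 0 Real.pi := fun l =>
      Continuous.intervalIntegrable (by fun_prop) _ _
    rw [intervalIntegral.integral_congr fun t _ => hsplit t, intervalIntegral.integral_const_mul,
      intervalIntegral.integral_sub (hc _) (hc _), ih, ih]
    have e1 : Complex.exp (-(Complex.I * (Real.pi / 2) * ((k + 1 : ℤ) : ℂ))) =
        -Complex.I * Complex.exp (-(Complex.I * (Real.pi / 2) * k)) := by
      rw [show -(Complex.I * (Real.pi / 2) * ((k + 1 : ℤ) : ℂ)) =
        -(Real.pi / 2 * Complex.I) + -(Complex.I * (Real.pi / 2) * k) by push_cast; ring,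
        Complex.exp_add, Complex.exp_neg, Complex.exp_pi_div_two_mul_I, Complex.inv_I]
    have e2 : Complex.exp (-(Complex.I * (Real.pi / 2) * ((k - 1 : ℤ) : ℂ))) =
        Complex.I * Complex.exp (-(Complex.I * (Real.pi / 2) * k)) := by
      rw [show -(Complex.I * (Real.pi / 2) * ((k - 1 : ℤ) : ℂ)) =
        (Real.pi / 2 * Complex.I) + -(Complex.I * (Real.pi / 2) * k) by push_cast; ring,
        Complex.exp_add, Complex.exp_pi_div_two_mul_I]
    rw [e1, e2]
    push_cast
    have g1 := Complex.one_div_Gamma_eq_self_mul_one_div_Gamma_add_one (((p : ℂ) + 1 - k) / 2)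
    have g2 := Complex.one_div_Gamma_eq_self_mul_one_div_Gamma_add_one (((p : ℂ) + 1 + k) / 2)
    rw [show (1 : ℂ) + (p + (k + 1)) / 2 = (p + 1 + k) / 2 + 1 by ring,
      show (1 : ℂ) + (p - (k + 1)) / 2 = (p + 1 - k) / 2 by ring,
      show (1 : ℂ) + (p + (k - 1)) / 2 = (p + 1 + k) / 2 by ring,
      show (1 : ℂ) + (p - (k - 1)) / 2 = (p + 1 - k) / 2 + 1 by ring,
      show (1 : ℂ) + (p + 1 + k) / 2 = (p + 1 + k) / 2 + 1 by ring,
      show (1 : ℂ) + (p + 1 - k) / 2 = (p + 1 - k) / 2 + 1 by ring, g1, g2, Nat.factorial_succ,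
      pow_succ]
    push_cast
    linear_combination (-(Real.pi : ℂ) * Complex.exp (-(Complex.I * (Real.pi / 2) * k)) *
      (p.factorial / 2 ^ p) * (Complex.Gamma ((p + 1 + k) / 2 + 1))⁻¹ *
      (Complex.Gamma ((p + 1 - k) / 2 + 1))⁻¹ * (p + 1) / 2) * Complex.I_sq

/-! ### Bessel functions of integer order -/

/-- The Bessel function `J_N` of natural order, as an entire function. -/
noncomputable def besselInt (N : ℕ) (x : ℂ) : ℂ := (x / 2) ^ N * besselSeries N x

theorem continuous_besselInt (N : ℕ) : Continuous (besselInt N) := by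
  unfold besselInt
  exact Continuous.mul (by fun_prop) (continuous_besselSeries _)

theorem hasSum_besselInt (N : ℕ) (x : ℂ) :
    HasSum (fun m : ℕ => (-1) ^ m * ((m.factorial : ℂ) * (m + N).factorial)⁻¹ *
      (x / 2) ^ (2 * m + N)) (besselInt N x) := by
  have h := ((summable_norm_besselSeries N x).of_norm.hasSum).mul_left ((x / 2) ^ N)
  refine hasSum_of_forall_eq (fun m => ?_) h
  rw [show (m : ℂ) + ((N : ℝ) : ℂ) + 1 = ((m + N : ℕ) : ℂ) + 1 by push_cast; ring,
    Complex.Gamma_nat_eq_factorial, pow_add]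
  ring

theorem norm_besselInt_term_le (N m : ℕ) (x : ℂ) :
    ‖(-1) ^ m * ((m.factorial : ℂ) * (m + N).factorial)⁻¹ * (x / 2) ^ (2 * m + N)‖ ≤
      (‖x‖ / 2) ^ N / N.factorial * ((‖x‖ / 2) ^ 2) ^ m / m.factorial := by
  have h0 : (N.factorial : ℝ) ≤ (m + N).factorial := by
    exact_mod_cast Nat.factorial_le (Nat.le_add_left N m)
  have h1 : (0 : ℝ) < N.factorial := by exact_mod_cast N.factorial_pos
  have h2 : (0 : ℝ) < m.factorial := by exact_mod_cast m.factorial_pos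
  simp only [norm_mul, norm_pow, norm_neg, norm_one, one_pow, one_mul, norm_inv, norm_div,
    Complex.norm_natCast, Complex.norm_ofNat]
  calc ((m.factorial : ℝ) * (m + N).factorial)⁻¹ * (‖x‖ / 2) ^ (2 * m + N)
      ≤ ((m.factorial : ℝ) * N.factorial)⁻¹ * (‖x‖ / 2) ^ (2 * m + N) := by gcongr
    _ = _ := by rw [pow_add, pow_mul]; field_simp

theorem summable_norm_besselInt (N : ℕ) (x : ℂ) :
    Summable fun m : ℕ =>
      ‖(-1) ^ m * ((m.factorial : ℂ) * (m + N).factorial)⁻¹ * (x / 2) ^ (2 * m + N)‖ := by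
  refine Summable.of_nonneg_of_le (fun _ => norm_nonneg _)
    (fun m => norm_besselInt_term_le N m x) ?_
  simp_rw [mul_div_assoc]
  exact (Real.summable_pow_div_factorial _).mul_left _

theorem norm_besselInt_le (N : ℕ) (x : ℂ) {R : ℝ} (hx : ‖x‖ ≤ R) :
    ‖besselInt N x‖ ≤ (R / 2) ^ N / N.factorial * Real.exp ((R / 2) ^ 2) := by
  have hs : HasSum (fun m : ℕ => (R / 2) ^ N / N.factorial * ((R / 2) ^ 2) ^ m / m.factorial)
      ((R / 2) ^ N / N.factorial * Real.exp ((R / 2) ^ 2)) := by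
    simp_rw [mul_div_assoc]
    have h := NormedSpace.expSeries_div_hasSum_exp ((R / 2) ^ 2)
    rw [← Real.exp_eq_exp_ℝ] at h
    exact h.mul_left _
  have hR : 0 ≤ R := (norm_nonneg x).trans hx
  refine (hasSum_besselInt N x).norm_le_of_bounded hs fun m =>
    (norm_besselInt_term_le N m x).trans ?_
  gcongr

/-- Lommel's integral: the half-circle Fourier coefficients of `t ↦ J_{|n|}(r sin t)` are products
of two Bessel functions. Both sides are expanded in powers of `r`. -/
theorem integral_besselInt_mul_exp (n k : ℤ) (r : ℂ) :
    ∫ t in (0 : ℝ)..Real.pi, besselInt n.natAbs (r * Real.sin t) *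
        Complex.exp (-(Complex.I * (k * t))) =
      Real.pi * Complex.exp (-(Complex.I * (Real.pi / 2) * k)) * besselPair n k (r / 2) := by
  set N := n.natAbs with hN
  set c : ℕ → ℂ := fun m => (-1) ^ m * ((m.factorial : ℂ) * (m + N).factorial)⁻¹ *
      (r / 2) ^ (2 * m + N) with hc
  let f : ℕ → C(ℝ, ℂ) := fun m =>
    ⟨fun t => c m * ((Real.sin t : ℂ) ^ (2 * m + N) * Complex.exp (-(Complex.I * (k * t)))),
      by fun_prop⟩
  have hsum : Summable fun m =>
      ‖(f m).restrict
        (⟨Set.uIcc (0 : ℝ) Real.pi, isCompact_uIcc⟩ : TopologicalSpace.Compacts ℝ)‖ := by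
    refine Summable.of_nonneg_of_le (fun _ => norm_nonneg _) (fun m => ?_)
      (summable_norm_besselInt N r)
    refine (ContinuousMap.norm_le _ (norm_nonneg _)).2 fun t => ?_
    change ‖c m * ((Real.sin t : ℂ) ^ (2 * m + N) * Complex.exp (-(Complex.I * (k * (t : ℝ)))))‖ ≤
      ‖c m‖
    rw [norm_mul (c m), norm_mul (_ ^ _), norm_pow, Complex.norm_real,
      show -(Complex.I * (k * ((t : ℝ) : ℂ))) = ((-(k * (t : ℝ)) : ℝ) : ℂ) * Complex.I by
        push_cast; ring, Complex.norm_exp_ofReal_mul_I, mul_one]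
    exact mul_le_of_le_one_right (norm_nonneg _)
      (pow_le_one₀ (norm_nonneg _) (Real.abs_sin_le_one _))
  have h := intervalIntegral.hasSum_intervalIntegral_of_summable_norm hsum
  have hL : ∀ t : ℝ, ∑' m, f m t = besselInt N (r * Real.sin t) *
      Complex.exp (-(Complex.I * (k * t))) := by
    intro t
    refine HasSum.tsum_eq ?_
    refine hasSum_of_forall_eq (fun m => ?_) ((hasSum_besselInt N (r * Real.sin t)).mul_right _)
    change c m * ((Real.sin t : ℂ) ^ (2 * m + N) * Complex.exp (-(Complex.I * (k * t)))) = _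
    rw [hc, show r * (Real.sin t : ℂ) / 2 = r / 2 * Real.sin t by ring, mul_pow]
    ring
  simp_rw [hL] at h
  refine h.unique ?_
  refine hasSum_of_forall_eq (fun m => ?_) ((hasSum_besselPair n k (r / 2)).mul_left
    (Real.pi * Complex.exp (-(Complex.I * (Real.pi / 2) * k))))
  change ∫ t in (0 : ℝ)..Real.pi, c m * ((Real.sin t : ℂ) ^ (2 * m + N) *
    Complex.exp (-(Complex.I * (k * t)))) = _
  rw [intervalIntegral.integral_const_mul, integral_sin_pow_mul_exp]
  simp only [hc]
  rw [show (1 : ℂ) + (((2 * m + N : ℕ) : ℂ) + k) / 2 = m + ((N : ℂ) + k) / 2 + 1 by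
      push_cast; ring,
    show (1 : ℂ) + (((2 * m + N : ℕ) : ℂ) - k) / 2 = m + ((N : ℂ) - k) / 2 + 1 by
      push_cast; ring, ← hN, div_pow (r / 2) 2]
  ring

/-- Position of a pair of naturals by its difference and its minimum. -/
def diffMinEquiv : ℕ × ℕ ≃ ℤ × ℕ where
  toFun p := ((p.1 : ℤ) - p.2, min p.1 p.2)
  invFun q := (q.2 + q.1.toNat, q.2 + (-q.1).toNat)
  left_inv p := by ext <;> (simp; omega)
  right_inv q := by ext <;> simp; omega

theorem jacobiAnger_term (x w : ℂ) (hw0 : w ≠ 0) (n : ℤ) (m : ℕ) :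
    (x / 2 * w) ^ (m + n.toNat) / ((m + n.toNat).factorial : ℂ) *
      ((-(x / 2) * w⁻¹) ^ (m + (-n).toNat) / ((m + (-n).toNat).factorial : ℂ)) =
    (-1) ^ (min n 0) * ((-1) ^ m * ((m.factorial : ℂ) * (m + n.natAbs).factorial)⁻¹ *
      (x / 2) ^ (2 * m + n.natAbs)) * w ^ n := by
  rcases le_total 0 n with h | h
  · obtain ⟨N, rfl⟩ := Int.eq_ofNat_of_zero_le h
    simp only [Int.toNat_natCast, Int.natAbs_natCast, Int.toNat_neg_natCast, add_zero,
      min_eq_right h, zpow_zero, zpow_natCast]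
    rw [mul_pow, mul_pow, neg_pow, pow_add (x / 2) (2 * m) N,
      pow_add (x / 2) m N, two_mul, pow_add (x / 2) m m, inv_pow, pow_add w m N]
    field_simp
  · obtain ⟨N, hN⟩ := Int.eq_ofNat_of_zero_le (neg_nonneg.2 h)
    obtain rfl : n = -(N : ℤ) := by omega
    simp only [Int.toNat_natCast, Int.natAbs_natCast, Int.toNat_neg_natCast, add_zero, neg_neg,
      Int.natAbs_neg, min_eq_left h, zpow_neg, zpow_natCast]
    rw [mul_pow, mul_pow, neg_pow, pow_add (x / 2) (2 * m) N,
      pow_add (x / 2) m N, two_mul, pow_add (x / 2) m m, inv_pow, pow_add w m N,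
      pow_add (-1 : ℂ) m N]
    have : ((-1 : ℂ) ^ N)⁻¹ = (-1) ^ N := by rw [← inv_pow]; norm_num
    rw [this]
    field_simp

/-- The Jacobi-Anger expansion: multiply the exponential series of `e^{xw/2}` and
`e^{-x/(2w)}`, `w = e^{iψ}`, and collect powers of `w`. -/
theorem hasSum_jacobiAnger (x : ℂ) (ψ : ℝ) :
    HasSum (fun n : ℤ => (-1) ^ (min n 0) * besselInt n.natAbs x *
      Complex.exp (Complex.I * (n * ψ))) (Complex.exp (Complex.I * (x * Real.sin ψ))) := by
  set w := Complex.exp (Complex.I * ψ) with hw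
  have hw0 : w ≠ 0 := Complex.exp_ne_zero _
  have hwn : ∀ n : ℤ, Complex.exp (Complex.I * (n * ψ)) = w ^ n := by
    intro n; rw [hw, ← Complex.exp_int_mul]; congr 1; ring
  have hwi : w⁻¹ = Complex.exp (-(Complex.I * ψ)) := by rw [hw, Complex.exp_neg]
  have hE : Complex.exp (Complex.I * (x * Real.sin ψ)) =
      Complex.exp (x / 2 * w) * Complex.exp (-(x / 2) * w⁻¹) := by
    rw [← Complex.exp_add, hwi, hw, Complex.ofReal_sin, Complex.sin]
    congr 1
    rw [show -(ψ : ℂ) * Complex.I = -(Complex.I * ψ) by ring, mul_comm (ψ : ℂ)]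
    linear_combination (x / 2 * (Complex.exp (-(Complex.I * ψ)) - Complex.exp (Complex.I * ψ))) *
      Complex.I_sq
  have hexp : ∀ z : ℂ, HasSum (fun n : ℕ => z ^ n / n.factorial) (Complex.exp z) := by
    intro z
    have := NormedSpace.expSeries_div_hasSum_exp z
    rwa [← Complex.exp_eq_exp_ℂ] at this
  have hn : ∀ z : ℂ, Summable fun n : ℕ => ‖z ^ n / n.factorial‖ := fun z =>
    NormedSpace.norm_expSeries_div_summable z
  have hP : HasSum (fun q : ℤ × ℕ => (x / 2 * w) ^ (q.2 + q.1.toNat) /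
        ((q.2 + q.1.toNat).factorial : ℂ) *
      ((-(x / 2) * w⁻¹) ^ (q.2 + (-q.1).toNat) / ((q.2 + (-q.1).toNat).factorial : ℂ)))
      (Complex.exp (Complex.I * (x * Real.sin ψ))) := by
    have hs := summable_mul_of_summable_norm (hn (x / 2 * w)) (hn (-(x / 2) * w⁻¹))
    have h := (hexp (x / 2 * w)).mul (hexp (-(x / 2) * w⁻¹)) hs
    rw [hE]
    exact diffMinEquiv.symm.hasSum_iff.2 h
  refine hP.prod_fiberwise fun n => ?_
  have hB := ((hasSum_besselInt n.natAbs x).mul_left ((-1) ^ (min n 0))).mul_right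
    (Complex.exp (Complex.I * (n * ψ)))
  refine hasSum_of_forall_eq (fun m => ?_) hB
  rw [hwn]
  exact jacobiAnger_term x w hw0 n m

/-! ### Symmetric partial sums of Fourier series -/

/-- The `k`-th Fourier coefficient of a function on `(-π, π]`. -/
noncomputable def circleCoeff (f : ℝ → ℂ) (k : ℤ) : ℂ :=
  (2 * Real.pi : ℂ)⁻¹ * ∫ t in (-Real.pi)..Real.pi, f t * Complex.exp (-(Complex.I * (k * t)))

/-- The symmetric partial sum of order `N` of the Fourier series of `f`, at the point `x`. -/
noncomputable def circlePartialSum (f : ℝ → ℂ) (N : ℕ) (x : ℝ) : ℂ :=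
  ∑ k ∈ Finset.Icc (-(N : ℤ)) N, circleCoeff f k * Complex.exp (Complex.I * (k * x))

theorem norm_exp_I_mul_int (k : ℤ) (x : ℝ) : ‖Complex.exp (Complex.I * (k * x))‖ = 1 := by
  rw [show Complex.I * (k * (x : ℂ)) = ((k * x : ℝ) : ℂ) * Complex.I by push_cast; ring,
    Complex.norm_exp_ofReal_mul_I]

theorem norm_exp_neg_I_mul_int (k : ℤ) (x : ℝ) : ‖Complex.exp (-(Complex.I * (k * x)))‖ = 1 := by
  rw [Complex.exp_neg, norm_inv, norm_exp_I_mul_int, inv_one]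

theorem intervalIntegrable_mul_exp {f : ℝ → ℂ} (hf : Measurable f) {C : ℝ}
    (hC : ∀ t, ‖f t‖ ≤ C) (k : ℤ) (a b : ℝ) :
    IntervalIntegrable (fun t => f t * Complex.exp (-(Complex.I * (k * t)))) volume a b := by
  refine (intervalIntegrable_const (c := C)).mono_fun
    (Measurable.aestronglyMeasurable (by fun_prop)) (Filter.Eventually.of_forall fun t => ?_)
  change ‖f t * _‖ ≤ ‖C‖
  rw [norm_mul, norm_exp_neg_I_mul_int, mul_one]
  exact (hC t).trans (le_abs_self C)

theorem circleCoeff_add {f g : ℝ → ℂ} (hf : Measurable f) (hg : Measurable g) {C D : ℝ}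
    (hC : ∀ t, ‖f t‖ ≤ C) (hD : ∀ t, ‖g t‖ ≤ D) (k : ℤ) :
    circleCoeff (fun t => f t + g t) k = circleCoeff f k + circleCoeff g k := by
  simp only [circleCoeff, add_mul]
  rw [intervalIntegral.integral_add (intervalIntegrable_mul_exp hf hC k _ _)
    (intervalIntegrable_mul_exp hg hD k _ _), mul_add]

theorem circleCoeff_const_mul (c : ℂ) (f : ℝ → ℂ) (k : ℤ) :
    circleCoeff (fun t => c * f t) k = c * circleCoeff f k := by
  simp only [circleCoeff, mul_assoc]
  rw [intervalIntegral.integral_const_mul]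
  ring

theorem circleCoeff_mul_exp (f : ℝ → ℂ) (k : ℤ) :
    circleCoeff (fun t => f t * Complex.exp (Complex.I * t)) k = circleCoeff f (k - 1) := by
  simp only [circleCoeff]
  congr 1
  refine intervalIntegral.integral_congr fun t _ => ?_
  rw [mul_assoc, ← Complex.exp_add]
  congr 2
  push_cast
  ring

theorem circleCoeff_one (k : ℤ) : circleCoeff (fun _ => 1) k = if k = 0 then 1 else 0 := by
  have hpi : (Real.pi : ℂ) ≠ 0 := by exact_mod_cast Real.pi_ne_zero
  rcases eq_or_ne k 0 with rfl | hk
  · simp [circleCoeff]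
    field_simp
    ring
  · have hk' : -(Complex.I * k) ≠ 0 :=
      neg_ne_zero.2 (mul_ne_zero Complex.I_ne_zero (by exact_mod_cast hk))
    have h := integral_exp_mul_complex (a := -Real.pi) (b := Real.pi) hk'
    have h2 : Complex.exp (-(Complex.I * k) * Real.pi) =
        Complex.exp (-(Complex.I * k) * ((-Real.pi : ℝ) : ℂ)) := by
      rw [Complex.exp_eq_exp_iff_exists_int]
      exact ⟨-k, by push_cast; ring⟩
    rw [h2, sub_self, zero_div] at h
    simp only [circleCoeff, one_mul, if_neg hk]
    rw [mul_eq_zero]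
    right
    rw [← h]
    refine intervalIntegral.integral_congr fun t _ => ?_
    congr 1
    ring

theorem norm_circleCoeff_le {f : ℝ → ℂ} {C : ℝ} (hC : ∀ t, ‖f t‖ ≤ C) (k : ℤ) :
    ‖circleCoeff f k‖ ≤ C := by
  have h := intervalIntegral.norm_integral_le_of_norm_le_const (a := -Real.pi) (b := Real.pi)
    (f := fun t => f t * Complex.exp (-(Complex.I * (k * t)))) (C := C) fun t _ => by
      rw [norm_mul, norm_exp_neg_I_mul_int, mul_one]; exact hC t
  have hpi := Real.pi_pos
  rw [circleCoeff, norm_mul, norm_inv, norm_mul, Complex.norm_real, Complex.norm_ofNat,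
    Real.norm_of_nonneg hpi.le]
  rw [sub_neg_eq_add, abs_of_pos (by positivity), ← two_mul] at h
  rw [inv_mul_le_iff₀ (by positivity)]
  linarith

/-- The Riemann-Lebesgue lemma for the coefficients on `(-π, π]`. -/
theorem tendsto_circleCoeff (f : ℝ → ℂ) {u : ℕ → ℤ}
    (hu : Filter.Tendsto (fun N => (u N : ℝ)) Filter.atTop (Filter.cocompact ℝ)) :
    Filter.Tendsto (fun N => circleCoeff f (u N)) Filter.atTop (nhds 0) := by
  have hpi : (2 * Real.pi)⁻¹ ≠ 0 := by positivity
  have h := (Real.tendsto_integral_exp_smul_cocompact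
    ((Set.Ioc (-Real.pi) Real.pi).indicator f)).comp
    ((Homeomorph.mulLeft₀ _ hpi).isClosedEmbedding.tendsto_cocompact.comp hu)
  have h2 := h.const_mul (2 * Real.pi : ℂ)⁻¹
  rw [mul_zero] at h2
  refine h2.congr fun N => ?_
  rw [circleCoeff, intervalIntegral.integral_of_le (by linarith [Real.pi_pos]),
    ← integral_indicator measurableSet_Ioc]
  simp only [Function.comp_apply]
  congr 2
  funext t
  by_cases ht : t ∈ Set.Ioc (-Real.pi) Real.pi
  · rw [Set.indicator_of_mem ht, Set.indicator_of_mem ht, Circle.smul_def, smul_eq_mul,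
      Real.fourierChar_apply, mul_comm]
    congr 2
    have hpi : (Real.pi : ℂ) ≠ 0 := by exact_mod_cast Real.pi_ne_zero
    simp only [Homeomorph.coe_mulLeft₀]
    push_cast
    field_simp
  · rw [Set.indicator_of_notMem ht, Set.indicator_of_notMem ht, smul_zero]

theorem sum_Icc_neg_succ {E : Type*} [AddCommMonoid E] (g : ℤ → E) (N : ℕ) :
    ∑ k ∈ Finset.Icc (-((N + 1 : ℕ) : ℤ)) ((N + 1 : ℕ) : ℤ), g k =
      ∑ k ∈ Finset.Icc (-(N : ℤ)) N, g k + (g (N + 1) + g (-(N + 1))) := by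
  have h : Finset.Icc (-((N + 1 : ℕ) : ℤ)) ((N + 1 : ℕ) : ℤ) =
      insert ((N : ℤ) + 1) (insert (-((N : ℤ) + 1)) (Finset.Icc (-(N : ℤ)) N)) := by
    ext k
    simp only [Finset.mem_Icc, Finset.mem_insert]
    omega
  rw [h, Finset.sum_insert, Finset.sum_insert]
  · rw [← add_assoc, add_comm]
  · simp
  · simp only [Finset.mem_insert, Finset.mem_Icc]
    omega

theorem sum_Icc_neg_telescope {E : Type*} [AddCommGroup E] (G : ℤ → E) (N : ℕ) :
    ∑ k ∈ Finset.Icc (-(N : ℤ)) N, (G k - G (k + 1)) = G (-N) - G (N + 1) := by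
  induction N with
  | zero => simp
  | succ N ih =>
    rw [sum_Icc_neg_succ, ih]
    push_cast
    rw [show -((N : ℤ) + 1) + 1 = -N by ring]
    abel

theorem abs_sin_sub_sin_le_norm (t x : ℝ) :
    |Real.sin t - Real.sin x| ≤ ‖Complex.exp (Complex.I * t) - Complex.exp (Complex.I * x)‖ := by
  have h := Complex.abs_im_le_norm (Complex.exp (Complex.I * t) - Complex.exp (Complex.I * x))
  rwa [Complex.sub_im, mul_comm, mul_comm Complex.I, Complex.exp_ofReal_mul_I_im,
    Complex.exp_ofReal_mul_I_im, mul_comm, mul_comm (x : ℂ)] at h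

/-- Chernoff's identity: if `f` is Lipschitz at `x`, then `f - f x` is `h · (e^{it} - e^{ix})` with
bounded `h`, and the partial sums of its Fourier series telescope. -/
theorem circlePartialSum_sub {f : ℝ → ℂ} (hf : Measurable f) {x C : ℝ} (hC0 : 0 ≤ C)
    (hC : ∀ t, ‖f t - f x‖ ≤ C * ‖Complex.exp (Complex.I * t) - Complex.exp (Complex.I * x)‖) :
    ∃ h : ℝ → ℂ, (∀ t, ‖h t‖ ≤ C) ∧ ∀ N : ℕ, circlePartialSum f N x - f x =
      Complex.exp (Complex.I * x) *
        (Complex.exp (Complex.I * ((-(N : ℤ) - 1 : ℤ) * x)) * circleCoeff h (-(N : ℤ) - 1) -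
          Complex.exp (Complex.I * (((N : ℤ) : ℂ) * x)) * circleCoeff h N) := by
  set h : ℝ → ℂ := fun t =>
    (f t - f x) / (Complex.exp (Complex.I * t) - Complex.exp (Complex.I * x))
    with hh
  have hm : Measurable h := by fun_prop
  have hb : ∀ t, ‖h t‖ ≤ C := fun t => by
    rw [hh, norm_div]
    exact div_le_of_le_mul₀ (norm_nonneg _) hC0 (hC t)
  have hmul : ∀ t, f t = f x * 1 +
      (h t * Complex.exp (Complex.I * t) + (-Complex.exp (Complex.I * x)) * h t) := by
    intro t
    rcases eq_or_ne (Complex.exp (Complex.I * t) - Complex.exp (Complex.I * x)) 0 with h0 | h0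
    · have := hC t
      rw [h0, norm_zero, mul_zero] at this
      have h1 : f t - f x = 0 := norm_le_zero_iff.1 this
      have h2 : h t = 0 := by simp only [hh, h0, div_zero]
      rw [h2]
      linear_combination h1
    · have : h t * (Complex.exp (Complex.I * t) - Complex.exp (Complex.I * x)) = f t - f x := by
        simp only [hh]
        field_simp
      linear_combination -this
  refine ⟨h, hb, fun N => ?_⟩
  have he : ∀ t : ℝ, ‖Complex.exp (Complex.I * t)‖ = 1 := fun t => by
    rw [mul_comm, Complex.norm_exp_ofReal_mul_I]
  have hcoef : ∀ k, circleCoeff f k = f x * (if k = 0 then 1 else 0) +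
      (circleCoeff h (k - 1) + (-Complex.exp (Complex.I * x)) * circleCoeff h k) := by
    intro k
    have b1 : ∀ t : ℝ, ‖f x * 1‖ ≤ ‖f x‖ := fun t => by simp
    have b2 : ∀ t : ℝ, ‖h t * Complex.exp (Complex.I * t)‖ ≤ C := fun t => by
      rw [norm_mul, he, mul_one]; exact hb t
    have b3 : ∀ t : ℝ, ‖(-Complex.exp (Complex.I * x)) * h t‖ ≤ C := fun t => by
      rw [norm_mul, norm_neg, he, one_mul]; exact hb t
    have b4 : ∀ t : ℝ, ‖h t * Complex.exp (Complex.I * t) + (-Complex.exp (Complex.I * x)) * h t‖ ≤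
        C + C := fun t => norm_add_le_of_le (b2 t) (b3 t)
    rw [← circleCoeff_one, ← circleCoeff_mul_exp, ← circleCoeff_const_mul, ← circleCoeff_const_mul,
      ← circleCoeff_add (by fun_prop) (by fun_prop) b2 b3,
      ← circleCoeff_add (by fun_prop) (by fun_prop) b1 b4]
    exact congrArg (fun g => circleCoeff g k) (funext hmul)
  set G : ℤ → ℂ := fun k => Complex.exp (Complex.I * ((k - 1 : ℤ) * x)) * circleCoeff h (k - 1)
    with hG
  have hterm : ∀ k : ℤ, circleCoeff f k * Complex.exp (Complex.I * (k * x)) =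
      (if k = 0 then f x else 0) + Complex.exp (Complex.I * x) * (G k - G (k + 1)) := by
    intro k
    have e1 : Complex.exp (Complex.I * (k * x)) =
        Complex.exp (Complex.I * x) * Complex.exp (Complex.I * ((k - 1 : ℤ) * x)) := by
      rw [← Complex.exp_add]; congr 1; push_cast; ring
    rw [hcoef]
    simp only [hG, add_sub_cancel_right]
    rcases eq_or_ne k 0 with rfl | hk
    · rw [if_pos rfl, if_pos rfl]
      have e0 : Complex.exp (Complex.I * (((0 : ℤ) : ℂ) * x)) = 1 := by simp
      linear_combination f x * e0 + circleCoeff h (0 - 1) * e1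
    · rw [if_neg hk, if_neg hk, e1]
      ring
  have hsum : circlePartialSum f N x =
      f x + Complex.exp (Complex.I * x) * (G (-N) - G (N + 1)) := by
    rw [circlePartialSum, Finset.sum_congr rfl fun k _ => hterm k, Finset.sum_add_distrib,
      ← Finset.mul_sum, sum_Icc_neg_telescope]
    congr 1
    simp
  rw [hsum, add_sub_cancel_left]
  simp only [hG, add_sub_cancel_right]

theorem norm_circlePartialSum_sub_le {f : ℝ → ℂ} (hf : Measurable f) {x C : ℝ} (hC0 : 0 ≤ C)
    (hC : ∀ t, ‖f t - f x‖ ≤ C * ‖Complex.exp (Complex.I * t) - Complex.exp (Complex.I * x)‖)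
    (N : ℕ) : ‖circlePartialSum f N x - f x‖ ≤ 2 * C := by
  obtain ⟨h, hb, hN⟩ := circlePartialSum_sub hf hC0 hC
  rw [hN, norm_mul, mul_comm Complex.I, Complex.norm_exp_ofReal_mul_I, one_mul]
  refine (norm_sub_le _ _).trans ?_
  rw [norm_mul, norm_mul, norm_exp_I_mul_int, norm_exp_I_mul_int, one_mul, one_mul, two_mul]
  exact add_le_add (norm_circleCoeff_le hb _) (norm_circleCoeff_le hb _)

theorem tendsto_circlePartialSum {f : ℝ → ℂ} (hf : Measurable f) {x C : ℝ} (hC0 : 0 ≤ C)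
    (hC : ∀ t, ‖f t - f x‖ ≤ C * ‖Complex.exp (Complex.I * t) - Complex.exp (Complex.I * x)‖) :
    Filter.Tendsto (fun N => circlePartialSum f N x) Filter.atTop (nhds (f x)) := by
  obtain ⟨h, hb, hN⟩ := circlePartialSum_sub hf hC0 hC
  have hnat : Filter.Tendsto (fun N : ℕ => (N : ℝ)) Filter.atTop Filter.atTop :=
    tendsto_natCast_atTop_atTop
  have t1 : Filter.Tendsto (fun N : ℕ => circleCoeff h (-(N : ℤ) - 1)) Filter.atTop (nhds 0) := by
    refine tendsto_circleCoeff h (Filter.Tendsto.mono_right ?_ atBot_le_cocompact)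
    push_cast
    exact Filter.tendsto_atBot_add_const_right _ _ (Filter.tendsto_neg_atTop_atBot.comp hnat)
  have t2 : Filter.Tendsto (fun N : ℕ => circleCoeff h (N : ℤ)) Filter.atTop (nhds 0) := by
    refine tendsto_circleCoeff h (Filter.Tendsto.mono_right ?_ atTop_le_cocompact)
    push_cast
    exact hnat
  rw [tendsto_iff_norm_sub_tendsto_zero]
  have t3 := t1.norm.add t2.norm
  rw [norm_zero, add_zero] at t3
  refine squeeze_zero (fun _ => norm_nonneg _) (fun N => ?_) t3
  rw [hN, norm_mul, mul_comm Complex.I, Complex.norm_exp_ofReal_mul_I, one_mul]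
  refine (norm_sub_le _ _).trans_eq ?_
  rw [norm_mul, norm_mul, norm_exp_I_mul_int, norm_exp_I_mul_int, one_mul, one_mul]

/-! ### Bounded partial sums for the square wave -/

/-- Summation by parts against the decreasing weights `1 / (k + 1)`. -/
theorem abs_sum_sub_div_le (T : ℕ → ℝ) {K : ℝ} (hT : ∀ m, |T m| ≤ K) (M j : ℕ) :
    |∑ i ∈ Finset.range j, (T (M + i + 1) - T (M + i)) / ((M + i : ℕ) + 1 : ℝ)| ≤
      2 * K / (M + 1) := by
  have key : ∀ j : ℕ, |∑ i ∈ Finset.range j, (T (M + i + 1) - T (M + i)) / ((M + i : ℕ) + 1 : ℝ) -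
      T (M + j) / ((M + j : ℕ) + 1)| ≤ 2 * K / (M + 1) - K / ((M + j : ℕ) + 1) := by
    intro j
    induction j with
    | zero =>
      simp only [Finset.range_zero, Finset.sum_empty, zero_sub, abs_neg, add_zero, abs_div]
      rw [abs_of_pos (by positivity : (0 : ℝ) < M + 1), ← sub_div, two_mul, add_sub_cancel_right]
      gcongr
      exact hT M
    | succ j ih =>
      rw [Finset.sum_range_succ]
      have hd : (0 : ℝ) ≤ 1 / ((M + j : ℕ) + 1) - 1 / ((M + (j + 1) : ℕ) + 1) := by
        rw [sub_nonneg]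
        gcongr
        omega
      have h1 := hT (M + j + 1)
      have hb : |T (M + j + 1) * (1 / ((M + j : ℕ) + 1) - 1 / ((M + (j + 1) : ℕ) + 1))| ≤
          K * (1 / ((M + j : ℕ) + 1) - 1 / ((M + (j + 1) : ℕ) + 1)) := by
        rw [abs_mul, abs_of_nonneg hd]
        gcongr
      have := abs_add_le _ _ |>.trans (add_le_add ih hb)
      refine le_trans (le_of_eq ?_) (this.trans (le_of_eq ?_))
      · congr 1
        rw [← add_assoc M j 1]
        ring
      · ring
  have h1 := key j
  have h2 : |T (M + j) / ((M + j : ℕ) + 1 : ℝ)| ≤ K / ((M + j : ℕ) + 1) := by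
    rw [abs_div, abs_of_pos (by positivity : (0 : ℝ) < ((M + j : ℕ) : ℝ) + 1)]
    gcongr
    exact hT _
  have h3 := abs_add_le (∑ i ∈ Finset.range j, (T (M + i + 1) - T (M + i)) / ((M + i : ℕ) + 1 : ℝ) -
      T (M + j) / ((M + j : ℕ) + 1)) (T (M + j) / ((M + j : ℕ) + 1 : ℝ))
  rw [sub_add_cancel] at h3
  linarith

theorem abs_sin_nat_mul_le (m : ℕ) (x : ℝ) : |Real.sin (m * x)| ≤ m * |Real.sin x| := by
  induction m with
  | zero => simp
  | succ m ih =>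
    push_cast
    rw [add_mul, one_mul, Real.sin_add]
    refine (abs_add_le _ _).trans ?_
    rw [abs_mul, abs_mul, add_mul, one_mul]
    exact add_le_add ((mul_le_of_le_one_right (abs_nonneg _) (Real.abs_cos_le_one _)).trans ih)
      (mul_le_of_le_one_left (abs_nonneg _) (Real.abs_cos_le_one _))

/-- The partial sums of `∑ sin (k x) / k` are uniformly bounded: with `s = |sin (x / 2)|`, the terms
with `k ≤ 1 / s` are at most `2 s`, and the others are summed by parts. -/
theorem abs_sum_sin_div_le (N : ℕ) (x : ℝ) :
    |∑ k ∈ Finset.range N, Real.sin ((k + 1 : ℕ) * x) / (k + 1 : ℕ)| ≤ 3 := by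
  set s := |Real.sin (x / 2)| with hs
  have hs0 : 0 ≤ s := abs_nonneg _
  have hsx : |Real.sin x| ≤ 2 * s := by
    conv_lhs => rw [show x = 2 * (x / 2) by ring, Real.sin_two_mul]
    rw [abs_mul, abs_mul, abs_two]
    exact mul_le_of_le_one_right (by positivity) (Real.abs_cos_le_one _)
  have hterm : ∀ k : ℕ, |Real.sin ((k + 1 : ℕ) * x) / (k + 1 : ℕ)| ≤ 2 * s := by
    intro k
    have hk : (0 : ℝ) < (k + 1 : ℕ) := by positivity
    have h1 := (abs_sin_nat_mul_le (k + 1) x).trans (mul_le_mul_of_nonneg_left hsx hk.le)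
    rw [abs_div, abs_of_pos hk, div_le_iff₀ hk]
    exact h1.trans_eq (mul_comm _ _)
  have hhead : ∀ M : ℕ, |∑ k ∈ Finset.range M, Real.sin ((k + 1 : ℕ) * x) / (k + 1 : ℕ)| ≤
      M * (2 * s) := by
    intro M
    refine (Finset.abs_sum_le_sum_abs _ _).trans ?_
    refine (Finset.sum_le_sum fun k _ => hterm k).trans_eq ?_
    simp
  rcases hs0.eq_or_lt with h0 | hpos
  · have := hhead N
    rw [← h0] at this
    linarith
  set M := ⌊1 / s⌋₊ with hM
  have hMs : M * (2 * s) ≤ 2 := by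
    have h1 : (M : ℝ) ≤ 1 / s := Nat.floor_le (by positivity)
    rw [le_div_iff₀ hpos] at h1
    linarith
  have hM1 : 1 ≤ (M + 1) * s := by
    have h1 : 1 / s < M + 1 := Nat.lt_floor_add_one _
    rw [div_lt_iff₀ hpos] at h1
    exact h1.le
  rcases le_total N M with hNM | hNM
  · have h1 : (N : ℝ) * (2 * s) ≤ M * (2 * s) := by gcongr
    linarith [hhead N]
  obtain ⟨j, rfl⟩ := Nat.exists_eq_add_of_le hNM
  have htail : |∑ i ∈ Finset.range j, Real.sin ((M + i + 1 : ℕ) * x) / (M + i + 1 : ℕ)| ≤ 1 := by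
    have h := abs_sum_sub_div_le (fun m => -Real.cos ((m + 1 / 2) * x)) (K := 1)
      (fun m => by rw [abs_neg]; exact Real.abs_cos_le_one _) M j
    have he : ∑ i ∈ Finset.range j,
        (-Real.cos (((M + i + 1 : ℕ) + 1 / 2) * x) - -Real.cos (((M + i : ℕ) + 1 / 2) * x)) /
          ((M + i : ℕ) + 1 : ℝ) = 2 * Real.sin (x / 2) *
        ∑ i ∈ Finset.range j, Real.sin ((M + i + 1 : ℕ) * x) / (M + i + 1 : ℕ) := by
      rw [Finset.mul_sum]
      refine Finset.sum_congr rfl fun i _ => ?_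
      rw [mul_div_assoc']
      congr 1
      · rw [show (((M + i + 1 : ℕ) : ℝ) + 1 / 2) * x = (M + i + 1 : ℕ) * x + x / 2 by ring,
          show (((M + i : ℕ) : ℝ) + 1 / 2) * x = (M + i + 1 : ℕ) * x - x / 2 by push_cast; ring,
          Real.cos_add, Real.cos_sub]
        ring
      · push_cast; ring
    rw [he, abs_mul, abs_mul, abs_two, ← hs, mul_one, le_div_iff₀ (by positivity)] at h
    set S := |∑ i ∈ Finset.range j, Real.sin ((M + i + 1 : ℕ) * x) / (M + i + 1 : ℕ)|
    have hS : 0 ≤ S := abs_nonneg _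
    nlinarith
  rw [Finset.sum_range_add]
  refine (abs_add_le _ _).trans ?_
  linarith [hhead M]

/-- The indicator function of `{sin ≥ 0}`, the elevations in `[0, π]` modulo `2π`, times
a function of the sine. -/
noncomputable def sineWindow (g : ℝ → ℂ) (t : ℝ) : ℂ := if 0 ≤ Real.sin t then g (Real.sin t) else 0

theorem measurable_sineWindow {g : ℝ → ℂ} (hg : Continuous g) : Measurable (sineWindow g) := by
  unfold sineWindow
  exact Measurable.ite (measurableSet_le measurable_const Real.measurable_sin)
    (hg.measurable.comp Real.measurable_sin) measurable_const

theorem circleCoeff_sineWindow {g : ℝ → ℂ} (hg : Continuous g) (k : ℤ) :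
    circleCoeff (sineWindow g) k = (2 * Real.pi : ℂ)⁻¹ *
      ∫ t in (0 : ℝ)..Real.pi, g (Real.sin t) * Complex.exp (-(Complex.I * (k * t))) := by
  have hpi := Real.pi_pos
  have h1 : Set.EqOn (fun t : ℝ => g (Real.sin t) * Complex.exp (-(Complex.I * (k * t))))
      (fun t => sineWindow g t * Complex.exp (-(Complex.I * (k * t)))) (Set.uIcc 0 Real.pi) := by
    intro t ht
    rw [Set.uIcc_of_le hpi.le] at ht
    simp only [sineWindow, if_pos (Real.sin_nonneg_of_mem_Icc ht)]
  have h2 : ∀ᵐ t : ℝ, t ∈ Set.uIoc (-Real.pi) 0 → (0 : ℂ) =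
      sineWindow g t * Complex.exp (-(Complex.I * (k * t))) := by
    have hne : ∀ᵐ t : ℝ, t ≠ 0 := by simp [ae_iff]
    filter_upwards [hne] with t h0 ht
    rw [Set.uIoc_of_le (by linarith)] at ht
    rcases eq_or_ne t (-Real.pi) with rfl | h3
    · exact absurd ht.1 (lt_irrefl _)
    · have : Real.sin t < 0 := Real.sin_neg_of_neg_of_neg_pi_lt (lt_of_le_of_ne ht.2 h0) ht.1
      simp only [sineWindow, if_neg (not_le.2 this), zero_mul]
  have i1 : IntervalIntegrable (fun t => sineWindow g t * Complex.exp (-(Complex.I * (k * t))))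
      volume 0 Real.pi := by
    refine IntervalIntegrable.congr (f := fun t : ℝ => g (Real.sin t) *
      Complex.exp (-(Complex.I * (k * t)))) ?_ (Continuous.intervalIntegrable (by fun_prop) _ _)
    exact fun t ht => h1 (Set.uIoc_subset_uIcc ht)
  have i2 : IntervalIntegrable (fun t => sineWindow g t * Complex.exp (-(Complex.I * (k * t))))
      volume (-Real.pi) 0 := by
    refine (IntervalIntegrable.zero (μ := volume)).congr_ae ?_
    rw [Filter.EventuallyEq, ae_restrict_iff' measurableSet_uIoc]
    exact h2
  rw [circleCoeff, ← intervalIntegral.integral_add_adjacent_intervals i2 i1,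
    ← intervalIntegral.integral_congr h1, ← intervalIntegral.integral_congr_ae h2]
  simp

theorem circleCoeff_sineWindow_one_zero : circleCoeff (sineWindow fun _ => 1) 0 = 1 / 2 := by
  have hpi : (Real.pi : ℂ) ≠ 0 := by exact_mod_cast Real.pi_ne_zero
  rw [circleCoeff_sineWindow continuous_const]
  simp
  field_simp

/-- The modes `±k` of the square wave together. -/
theorem circleCoeff_sineWindow_one_pair (k : ℤ) (hk : k ≠ 0) (x : ℝ) :
    circleCoeff (sineWindow fun _ => 1) k * Complex.exp (Complex.I * (k * x)) +
      circleCoeff (sineWindow fun _ => 1) (-k) * Complex.exp (Complex.I * ((-k : ℤ) * x)) =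
    (((Real.sin (k * x) - Real.sin (k * (x - Real.pi))) / (Real.pi * k) : ℝ) : ℂ) := by
  have hpi : (Real.pi : ℂ) ≠ 0 := by exact_mod_cast Real.pi_ne_zero
  have key : ∀ k : ℤ, k ≠ 0 →
      circleCoeff (sineWindow fun _ => 1) k * Complex.exp (Complex.I * (k * x)) =
        (Complex.exp (k * x * Complex.I) - Complex.exp (k * (x - Real.pi) * Complex.I)) /
          (2 * Real.pi * Complex.I * k) := by
    intro k hk
    have hkc : (k : ℂ) ≠ 0 := by exact_mod_cast hk
    have h := integral_exp_mul_complex (a := 0) (b := Real.pi) (c := -(Complex.I * k))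
      (neg_ne_zero.2 (mul_ne_zero Complex.I_ne_zero hkc))
    rw [circleCoeff_sineWindow continuous_const]
    have : ∫ t in (0 : ℝ)..Real.pi, (1 : ℂ) * Complex.exp (-(Complex.I * (k * t))) =
        ∫ t in (0 : ℝ)..Real.pi, Complex.exp (-(Complex.I * k) * t) :=
      intervalIntegral.integral_congr fun t _ => by
        rw [one_mul]; congr 1; ring
    rw [this, h]
    rw [show (k : ℂ) * (x - Real.pi) * Complex.I = -(Complex.I * k) * Real.pi + k * x * Complex.I by
      ring, Complex.exp_add, show Complex.I * (k * (x : ℂ)) = k * x * Complex.I by ring]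
    simp only [Complex.ofReal_zero, mul_zero, Complex.exp_zero]
    have hI := Complex.I_ne_zero
    field_simp
    ring
  have hkc : (k : ℂ) ≠ 0 := by exact_mod_cast hk
  rw [key k hk, key (-k) (neg_ne_zero.2 hk)]
  push_cast
  rw [Complex.sin, Complex.sin]
  have hI := Complex.I_ne_zero
  have e1 : -(k : ℂ) * x * Complex.I = -(k * x) * Complex.I := by ring
  have e2 : -(k : ℂ) * (x - Real.pi) * Complex.I = -(k * (x - Real.pi)) * Complex.I := by ring
  rw [e1, e2]
  field_simp
  rw [Complex.I_sq]
  ring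

theorem norm_circlePartialSum_sineWindow_one_le (N : ℕ) (x : ℝ) :
    ‖circlePartialSum (sineWindow fun _ => 1) N x‖ ≤ 7 := by
  have hform : circlePartialSum (sineWindow fun _ => 1) N x = 1 / 2 +
      ((1 / Real.pi * (∑ k ∈ Finset.range N, Real.sin ((k + 1 : ℕ) * x) / (k + 1 : ℕ) -
        ∑ k ∈ Finset.range N, Real.sin ((k + 1 : ℕ) * (x - Real.pi)) / (k + 1 : ℕ)) : ℝ) : ℂ) := by
    induction N with
    | zero => simp [circlePartialSum, circleCoeff_sineWindow_one_zero]
    | succ N ih =>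
      rw [circlePartialSum] at ih ⊢
      rw [sum_Icc_neg_succ, ih, circleCoeff_sineWindow_one_pair _ (by omega),
        Finset.sum_range_succ, Finset.sum_range_succ, add_assoc, ← Complex.ofReal_add]
      congr 2
      generalize ∑ k ∈ Finset.range N, Real.sin ((k + 1 : ℕ) * x) / (k + 1 : ℕ) = A
      generalize ∑ k ∈ Finset.range N, Real.sin ((k + 1 : ℕ) * (x - Real.pi)) / (k + 1 : ℕ) = B
      push_cast
      field_simp
      ring
  have h1 := abs_sum_sin_div_le N x
  have h2 := abs_sum_sin_div_le N (x - Real.pi)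
  rw [hform]
  refine (norm_add_le _ _).trans ?_
  rw [Complex.norm_real, Real.norm_eq_abs, abs_mul, abs_of_pos (by positivity)]
  have h3 : 1 / Real.pi ≤ 1 := by
    rw [div_le_one Real.pi_pos]; linarith [Real.pi_gt_three]
  have h4 := (abs_sub _ _).trans (add_le_add h1 h2)
  have h5 : 1 / Real.pi * |∑ k ∈ Finset.range N, Real.sin ((k + 1 : ℕ) * x) / (k + 1 : ℕ) -
        ∑ k ∈ Finset.range N, Real.sin ((k + 1 : ℕ) * (x - Real.pi)) / (k + 1 : ℕ)| ≤
      1 * (3 + 3) := by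
    gcongr
  norm_num at h5 ⊢
  linarith

/-! ### Fourier series of windowed functions of the sine -/

/-- Points on opposite sides of an edge of the window have sines that differ by at least `|b|`. -/
theorem one_le_abs_sub_div {a b : ℝ} (h : a < 0 ∧ 0 ≤ b ∨ 0 ≤ a ∧ b < 0) (hb : b ≠ 0) :
    1 ≤ |a - b| / |b| := by
  rw [le_div_iff₀ (abs_pos.2 hb), one_mul]
  rcases h with ⟨h1, h2⟩ | ⟨h1, h2⟩
  · rw [abs_of_nonneg h2, abs_of_neg (by linarith)]; linarith
  · rw [abs_of_neg h2, abs_of_nonneg (by linarith)]; linarith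

/-- Away from the edges of the window, the Fourier series converges to the windowed function. -/
theorem tendsto_circlePartialSum_sineWindow {g : ℝ → ℂ} (hg : Continuous g) {L : NNReal}
    (hL : LipschitzOnWith L g (Set.Icc (-1) 1)) {x : ℝ} (hx : Real.sin x ≠ 0) :
    Filter.Tendsto (fun N => circlePartialSum (sineWindow g) N x) Filter.atTop
      (nhds (sineWindow g x)) := by
  obtain ⟨B, hB⟩ := (isCompact_Icc (a := (-1 : ℝ)) (b := 1)).exists_bound_of_continuousOn
    hg.continuousOn
  have hB0 : 0 ≤ B := (norm_nonneg _).trans (hB 0 (by simp))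
  have hmem : ∀ t, Real.sin t ∈ Set.Icc (-1 : ℝ) 1 := Real.sin_mem_Icc
  refine tendsto_circlePartialSum (C := L + B / |Real.sin x|) (measurable_sineWindow hg)
    (by positivity) fun t => ?_
  refine le_trans ?_ (mul_le_mul_of_nonneg_left (abs_sin_sub_sin_le_norm t x) (by positivity))
  have hedge : ∀ y, ‖g (Real.sin y)‖ ≤ B := fun y => hB _ (hmem y)
  have hfar : (Real.sin t < 0 ∧ 0 ≤ Real.sin x ∨ 0 ≤ Real.sin t ∧ Real.sin x < 0) →
      ∀ y, ‖g (Real.sin y)‖ ≤ (L + B / |Real.sin x|) * |Real.sin t - Real.sin x| := by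
    intro h y
    have h1 := one_le_abs_sub_div h hx
    have h2 : B * 1 ≤ B * (|Real.sin t - Real.sin x| / |Real.sin x|) := by gcongr
    have h3 : 0 ≤ L * |Real.sin t - Real.sin x| := by positivity
    calc ‖g (Real.sin y)‖ ≤ B * 1 := by rw [mul_one]; exact hedge y
      _ ≤ B * (|Real.sin t - Real.sin x| / |Real.sin x|) := h2
      _ ≤ L * |Real.sin t - Real.sin x| + B * (|Real.sin t - Real.sin x| / |Real.sin x|) := by
        linarith
      _ = _ := by ring
  unfold sineWindow
  split_ifs with h1 h2 h2
  · have := hL.dist_le_mul _ (hmem t) _ (hmem x)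
    rw [dist_eq_norm, Real.dist_eq] at this
    refine this.trans ?_
    gcongr
    exact le_add_of_nonneg_right (by positivity)
  · rw [sub_zero]
    exact hfar (Or.inr ⟨h1, not_le.1 h2⟩) t
  · rw [zero_sub, norm_neg]
    exact hfar (Or.inl ⟨not_le.1 h1, h2⟩) x
  · rw [sub_zero, norm_zero]; positivity

/-- The partial sums are uniformly bounded: the windowed function is a Lipschitz function plus
a multiple of the square wave. -/
theorem exists_norm_circlePartialSum_sineWindow_le {g : ℝ → ℂ} (hg : Continuous g) {L : NNReal}
    (hL : LipschitzOnWith L g (Set.Icc (-1) 1)) :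
    ∃ C, ∀ N x, ‖circlePartialSum (sineWindow g) N x‖ ≤ C := by
  obtain ⟨B, hB⟩ := (isCompact_Icc (a := (-1 : ℝ)) (b := 1)).exists_bound_of_continuousOn
    hg.continuousOn
  set p : ℝ → ℝ := fun t => max (Real.sin t) 0 with hp
  have hpm : ∀ t, p t ∈ Set.Icc (-1 : ℝ) 1 := fun t =>
    ⟨le_max_of_le_left (Real.neg_one_le_sin t), max_le (Real.sin_le_one t) zero_le_one⟩
  have hpc : Continuous p := Real.continuous_sin.max continuous_const
  have hgp : Continuous fun t => g (p t) := hg.comp hpc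
  -- On the window `p = sin`; off it both sides of the decomposition vanish.
  have hdec : sineWindow g = fun t => g (p t) +
      (g 0 * sineWindow (fun _ => 1) t + (-g 0) * 1) := by
    funext t
    simp only [sineWindow, hp]
    split_ifs with h
    · rw [max_eq_left h]; ring
    · rw [max_eq_right (not_le.1 h).le]; ring
  have hwm : Measurable (sineWindow fun _ => 1) := measurable_sineWindow continuous_const
  have hw1 : ∀ t, ‖sineWindow (fun _ => 1) t‖ ≤ 1 := fun t => by
    unfold sineWindow; split_ifs <;> simp
  have b1 : ∀ t, ‖g (p t)‖ ≤ B := fun t => hB _ (hpm t)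
  have b2 : ∀ t, ‖g 0 * sineWindow (fun _ => 1) t‖ ≤ ‖g 0‖ := fun t => by
    rw [norm_mul]; exact mul_le_of_le_one_right (norm_nonneg _) (hw1 t)
  have b3 : ∀ t : ℝ, ‖(-g 0) * 1‖ ≤ ‖g 0‖ := fun t => by simp
  have b4 : ∀ t : ℝ, ‖g 0 * sineWindow (fun _ => 1) t + (-g 0) * 1‖ ≤ ‖g 0‖ + ‖g 0‖ := fun t =>
    norm_add_le_of_le (b2 t) (b3 t)
  have hcoef : ∀ k, circleCoeff (sineWindow g) k = circleCoeff (fun t => g (p t)) k +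
      (g 0 * circleCoeff (sineWindow fun _ => 1) k + (-g 0) * if k = 0 then 1 else 0) := by
    intro k
    rw [← circleCoeff_one, ← circleCoeff_const_mul, ← circleCoeff_const_mul,
      ← circleCoeff_add (by fun_prop) (by fun_prop) b2 b3,
      ← circleCoeff_add hgp.measurable (by fun_prop) b1 b4, hdec]
  refine ⟨B + 2 * L + ‖g 0‖ * 7 + ‖g 0‖, fun N x => ?_⟩
  have hsum : circlePartialSum (sineWindow g) N x = circlePartialSum (fun t => g (p t)) N x +
      g 0 * circlePartialSum (sineWindow fun _ => 1) N x + -g 0 := by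
    simp only [circlePartialSum, hcoef, add_mul, Finset.sum_add_distrib, Finset.mul_sum, mul_assoc]
    rw [add_assoc]
    congr 2
    simp
  have hlip : ∀ t, ‖g (p t) - g (p x)‖ ≤
      L * ‖Complex.exp (Complex.I * t) - Complex.exp (Complex.I * x)‖ := by
    intro t
    have h1 := hL.dist_le_mul _ (hpm t) _ (hpm x)
    rw [dist_eq_norm, Real.dist_eq] at h1
    refine h1.trans (mul_le_mul_of_nonneg_left ?_ L.2)
    exact (abs_max_sub_max_le_abs _ _ _).trans (abs_sin_sub_sin_le_norm t x)
  have h1 := norm_circlePartialSum_sub_le (f := fun t => g (p t)) hgp.measurable L.2 hlip N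
  have h2 : ‖circlePartialSum (fun t => g (p t)) N x‖ ≤ B + 2 * L := by
    have h3 := norm_add_le (circlePartialSum (fun t => g (p t)) N x - g (p x)) (g (p x))
    rw [sub_add_cancel] at h3
    linarith [b1 x, show (L.1 : ℝ) = (L : ℝ) from rfl]
  rw [hsum]
  refine (norm_add₃_le).trans ?_
  rw [norm_neg, norm_mul]
  gcongr
  exact norm_circlePartialSum_sineWindow_one_le N x

/-! ### The windowed Bessel functions -/

theorem differentiable_besselSeries (ν : ℝ) : Differentiable ℂ (besselSeries ν) := by
  have hr : (Complex.regularizedHGFunSeries 0 {(ν : ℂ) + 1}).radius = ⊤ :=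
    Complex.radius_regularizedHGFunSeries_eq_top (by simp)
  have hc : Differentiable ℂ (Complex.regularizedHGFun 0 {(ν : ℂ) + 1}) := by
    have h := ((Complex.regularizedHGFunSeries 0 {(ν : ℂ) + 1}).hasFPowerSeriesOnBall
      (by rw [hr]; exact ENNReal.zero_lt_top)).differentiableOn
    rw [hr, Metric.eball_top] at h
    exact differentiableOn_univ.mp h
  rw [show besselSeries ν = fun z => Complex.regularizedHGFun 0 {(ν : ℂ) + 1} (-(z / 2) ^ 2) from
    funext (besselSeries_eq ν)]
  exact hc.comp (by fun_prop)

theorem exists_lipschitzOnWith_besselInt (N : ℕ) (r : ℂ) :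
    ∃ L : NNReal, LipschitzOnWith L (fun s : ℝ => besselInt N (r * s)) (Set.Icc (-1) 1) := by
  have hd : Differentiable ℂ (besselInt N) := by
    unfold besselInt
    exact Differentiable.mul (by fun_prop) (differentiable_besselSeries _)
  have h1 : ContDiff ℝ 1 (besselInt N) := hd.contDiff.restrict_scalars ℝ
  have h2 : ContDiff ℝ 1 fun s : ℝ => r * (s : ℂ) :=
    contDiff_const.mul Complex.ofRealCLM.contDiff
  exact (h1.comp h2).locallyLipschitz.locallyLipschitzOn.exists_lipschitzOnWith_of_compact
    isCompact_Icc

/-- The windowed Bessel function `t ↦ 1_{sin t ≥ 0} J_{|n|}(r sin t)`. -/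
noncomputable def besselWindow (n : ℤ) (r : ℂ) : ℝ → ℂ :=
  sineWindow fun s => besselInt n.natAbs (r * s)

theorem continuous_besselInt_mul (N : ℕ) (r : ℂ) :
    Continuous fun s : ℝ => besselInt N (r * s) :=
  (continuous_besselInt N).comp (by fun_prop)

theorem measurable_besselWindow (n : ℤ) (r : ℂ) : Measurable (besselWindow n r) :=
  measurable_sineWindow (continuous_besselInt_mul _ _)

theorem norm_besselWindow_le (n : ℤ) (r : ℂ) (t : ℝ) :
    ‖besselWindow n r t‖ ≤
      (‖r‖ / 2) ^ n.natAbs / n.natAbs.factorial * Real.exp ((‖r‖ / 2) ^ 2) := by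
  unfold besselWindow sineWindow
  split_ifs with h
  · refine norm_besselInt_le _ _ ?_
    rw [norm_mul, Complex.norm_real]
    exact mul_le_of_le_one_right (norm_nonneg _) (Real.abs_sin_le_one t)
  · rw [norm_zero]; positivity

/-- The constants of the fourfold series are Fourier coefficients of windowed Bessel functions. -/
theorem circleCoeff_besselWindow (n k : ℤ) (r : ℂ) :
    circleCoeff (besselWindow n r) k =
      1 / 2 * (Complex.exp (-(Complex.I * (Real.pi / 2) * k)) * besselPair n k (r / 2)) := by
  have hpi : (Real.pi : ℂ) ≠ 0 := by exact_mod_cast Real.pi_ne_zero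
  rw [besselWindow, circleCoeff_sineWindow (continuous_besselInt_mul _ _),
    integral_besselInt_mul_exp]
  field_simp

theorem tendsto_circlePartialSum_besselWindow (n : ℤ) (r : ℂ) {x : ℝ} (hx : Real.sin x ≠ 0) :
    Filter.Tendsto (fun N => circlePartialSum (besselWindow n r) N x) Filter.atTop
      (nhds (besselWindow n r x)) := by
  obtain ⟨L, hL⟩ := exists_lipschitzOnWith_besselInt n.natAbs r
  exact tendsto_circlePartialSum_sineWindow (continuous_besselInt_mul _ _) hL hx

theorem exists_norm_circlePartialSum_besselWindow_le (n : ℤ) (r : ℂ) :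
    ∃ C, ∀ N x, ‖circlePartialSum (besselWindow n r) N x‖ ≤ C := by
  obtain ⟨L, hL⟩ := exists_lipschitzOnWith_besselInt n.natAbs r
  exact exists_norm_circlePartialSum_sineWindow_le (continuous_besselInt_mul _ _) hL

/-! ### Expectations over the ray angles -/

section Angles

variable {Ω : Type*} [MeasurableSpace Ω]

/-- A sum with one independent summand that has a density almost surely avoids the countable set
`πℤ`. -/
theorem ae_sin_add_ne_zero {P : Measure Ω} [IsProbabilityMeasure P] {X Y : Ω → ℝ}
    (hX : Measurable X) (hY : Measurable Y) (hXY : IndepFun X Y P) (hac : P.map Y ≪ volume) :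
    ∀ᵐ ω ∂P, Real.sin (X ω + Y ω) ≠ 0 := by
  have hprod := (indepFun_iff_map_prod_eq_prod_map_map hX.aemeasurable hY.aemeasurable).1 hXY
  have hS : MeasurableSet {p : ℝ × ℝ | Real.sin (p.1 + p.2) ≠ 0} :=
    (measurableSet_eq_fun (by fun_prop) measurable_const).compl
  have : IsProbabilityMeasure (P.map Y) := Measure.isProbabilityMeasure_map hY.aemeasurable
  have hb : ∀ a : ℝ, ∀ᵐ b : ℝ, Real.sin (a + b) ≠ 0 := fun a => by
    have hc : {b : ℝ | Real.sin (a + b) = 0}.Countable := by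
      refine (Set.countable_range fun n : ℤ => n * Real.pi - a).mono fun b hb => ?_
      obtain ⟨n, hn⟩ := Real.sin_eq_zero_iff.1 hb
      exact ⟨n, by simp only [hn]; ring⟩
    rw [ae_iff]
    simpa using hc.measure_zero volume
  have h : ∀ᵐ p ∂(P.map fun ω => (X ω, Y ω)), p ∈ {p : ℝ × ℝ | Real.sin (p.1 + p.2) ≠ 0} := by
    rw [hprod, Measure.ae_prod_mem_iff_ae_ae_mem hS]
    exact Filter.Eventually.of_forall fun a => hac.ae_le (hb a)
  exact ae_of_ae_map (hX.prodMk hY).aemeasurable h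

/-- The only use of independence of all six angles: the characteristic function factors. -/
theorem integral_exp_angles {P : Measure Ω} {φc θc Δ₁ Δ₂ δ₁ δ₂ : Ω → ℝ}
    (hφc : Measurable φc) (hθc : Measurable θc)
    (hΔ₁ : Measurable Δ₁) (hΔ₂ : Measurable Δ₂) (hδ₁ : Measurable δ₁) (hδ₂ : Measurable δ₂)
    (hindep : iIndepFun ![φc, θc, Δ₁, Δ₂, δ₁, δ₂] P) (n n' k k' : ℤ) :
    ∫ ω, Complex.exp (Complex.I * (n * (φc ω + Δ₁ ω : ℝ))) *
        Complex.exp (Complex.I * (n' * (φc ω + Δ₂ ω : ℝ))) *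
        Complex.exp (Complex.I * (k * (θc ω + δ₁ ω : ℝ))) *
        Complex.exp (Complex.I * (k' * (θc ω + δ₂ ω : ℝ))) ∂P =
      angleChar P φc (n + n') * angleChar P Δ₁ n * angleChar P Δ₂ n' *
        angleChar P θc (k + k') * angleChar P δ₁ k * angleChar P δ₂ k' := by
  set c : Fin 6 → ℤ := ![n + n', k + k', n, n', k, k'] with hc
  have h := hindep.integral_fun_prod_comp (𝕜 := ℂ)
    (f := fun i x => Complex.exp (Complex.I * (c i * (x : ℝ))))
    (fun i => by fin_cases i <;> simpa using Measurable.aemeasurable (by assumption))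
    (fun i => Measurable.aestronglyMeasurable (by fun_prop))
  simp only [Fin.prod_univ_six] at h
  have e : ∀ ω, Complex.exp (Complex.I * (n * (φc ω + Δ₁ ω : ℝ))) *
        Complex.exp (Complex.I * (n' * (φc ω + Δ₂ ω : ℝ))) *
        Complex.exp (Complex.I * (k * (θc ω + δ₁ ω : ℝ))) *
        Complex.exp (Complex.I * (k' * (θc ω + δ₂ ω : ℝ))) =
      Complex.exp (Complex.I * ((n + n' : ℤ) * φc ω)) *
        Complex.exp (Complex.I * ((k + k' : ℤ) * θc ω)) * Complex.exp (Complex.I * (n * Δ₁ ω)) *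
        Complex.exp (Complex.I * (n' * Δ₂ ω)) * Complex.exp (Complex.I * (k * δ₁ ω)) *
        Complex.exp (Complex.I * (k' * δ₂ ω)) := by
    intro ω
    simp only [← Complex.exp_add]
    congr 1
    push_cast
    ring
  simp_rw [e]
  refine Eq.trans h ?_
  change angleChar P φc (n + n') * angleChar P θc (k + k') * angleChar P Δ₁ n *
    angleChar P Δ₂ n' * angleChar P δ₁ k * angleChar P δ₂ k' = _
  ring

theorem angleChar_congr {P : Measure Ω} {X Y : Ω → ℝ} (h : IdentDistrib X Y P P) (n : ℤ) :
    angleChar P X n = angleChar P Y n :=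
  (h.comp (u := fun x : ℝ => Complex.exp (Complex.I * (n * x))) (by fun_prop)).integral_eq

/-- Termwise integration of the Fourier series of a windowed Bessel function at a random angle. -/
theorem hasSum_integral_besselWindow {P : Measure Ω} [IsProbabilityMeasure P] {U : Ω → ℂ}
    (hU : Measurable U) {B : ℝ} (hB : ∀ ω, ‖U ω‖ ≤ B) {θ : Ω → ℝ} (hθ : Measurable θ)
    (hsin : ∀ᵐ ω ∂P, Real.sin (θ ω) ≠ 0) (n : ℤ) (r : ℂ) :
    HasSum (fun k : ℤ => ∫ ω, U ω * (circleCoeff (besselWindow n r) k *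
        Complex.exp (Complex.I * (k * θ ω))) ∂P)
      (∫ ω, U ω * besselWindow n r (θ ω) ∂P) (SummationFilter.symmetricIcc ℤ) := by
  obtain ⟨C, hC⟩ := exists_norm_circlePartialSum_besselWindow_le n r
  rw [SummationFilter.hasSum_symmetricIcc_iff]
  have hint : ∀ k : ℤ, Integrable (fun ω => U ω * (circleCoeff (besselWindow n r) k *
        Complex.exp (Complex.I * (k * θ ω)))) P := by
    intro k
    refine Integrable.of_bound (C := B * ‖circleCoeff (besselWindow n r) k‖)
      (Measurable.aestronglyMeasurable (by fun_prop)) (Filter.Eventually.of_forall fun ω => ?_)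
    rw [norm_mul, norm_mul, norm_exp_I_mul_int, mul_one]
    gcongr
    exact hB ω
  have hsum : ∀ N : ℕ, ∑ k ∈ Finset.Icc (-(N : ℤ)) N, ∫ ω, U ω *
      (circleCoeff (besselWindow n r) k * Complex.exp (Complex.I * (k * θ ω))) ∂P =
      ∫ ω, U ω * circlePartialSum (besselWindow n r) N (θ ω) ∂P := by
    intro N
    rw [← integral_finsetSum _ fun k _ => hint k]
    simp only [circlePartialSum, Finset.mul_sum]
  simp_rw [hsum]
  refine tendsto_integral_of_dominated_convergence (fun _ => B * C) (fun N => ?_)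
    (integrable_const _) (fun N => Filter.Eventually.of_forall fun ω => ?_) ?_
  · refine Measurable.aestronglyMeasurable (hU.mul ?_)
    unfold circlePartialSum
    fun_prop
  · rw [norm_mul]
    exact mul_le_mul (hB ω) (hC N _) (norm_nonneg _) ((norm_nonneg _).trans (hB ω))
  · filter_upwards [hsin] with ω hω
    exact (tendsto_circlePartialSum_besselWindow n r hω).const_mul _

end Angles

/-! ### The plane wave of an antenna pair -/

theorem zT_mul_sin_add_phaseAngle (z₁ z₂ φ : ℝ) :
    zT z₁ z₂ * Real.sin (φ + phaseAngle z₁ z₂) =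
      2 * Real.pi * (z₁ * Real.cos φ + z₂ * Real.sin φ) := by
  have hn : ‖(⟨z₂, z₁⟩ : ℂ)‖ = Real.sqrt (z₁ ^ 2 + z₂ ^ 2) := by
    rw [Complex.norm_def, Complex.normSq_mk]
    congr 1
    ring
  have hc := Complex.norm_mul_cos_arg (⟨z₂, z₁⟩ : ℂ)
  have hs := Complex.norm_mul_sin_arg (⟨z₂, z₁⟩ : ℂ)
  rw [hn] at hc hs
  simp only at hc hs
  rw [zT, phaseAngle, Real.sin_add]
  linear_combination (2 * Real.pi * Real.sin φ) * hc + (2 * Real.pi * Real.cos φ) * hs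

/-- The wave `e^{jr sin θ sin ψ}`, restricted to elevations in `[0, π]` modulo `2π`. -/
noncomputable def windowWave (r : ℂ) (ψ θ : ℝ) : ℂ :=
  sineWindow (fun s => Complex.exp (Complex.I * (r * s * Real.sin ψ))) θ

theorem measurable_windowWave (r : ℂ) {Ω : Type*} [MeasurableSpace Ω] {ψ θ : Ω → ℝ}
    (hψ : Measurable ψ) (hθ : Measurable θ) : Measurable fun ω => windowWave r (ψ ω) (θ ω) := by
  unfold windowWave sineWindow
  exact Measurable.ite (measurableSet_le measurable_const (Real.measurable_sin.comp hθ))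
    (by fun_prop) measurable_const

theorem norm_windowWave_le (r : ℝ) (ψ θ : ℝ) : ‖windowWave r ψ θ‖ ≤ 1 := by
  unfold windowWave sineWindow
  split_ifs
  · change ‖Complex.exp (Complex.I * ((r : ℂ) * (Real.sin θ : ℂ) * (Real.sin ψ : ℂ)))‖ ≤ 1
    rw [show Complex.I * ((r : ℂ) * (Real.sin θ : ℂ) * (Real.sin ψ : ℂ)) =
      ((r * Real.sin θ * Real.sin ψ : ℝ) : ℂ) * Complex.I by push_cast; ring,
      Complex.norm_exp_ofReal_mul_I]
  · simp

theorem hasSum_windowWave (r : ℂ) (ψ θ : ℝ) :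
    HasSum (fun n : ℤ => (-1) ^ (min n 0) * besselWindow n r θ *
      Complex.exp (Complex.I * (n * ψ))) (windowWave r ψ θ) := by
  unfold windowWave besselWindow sineWindow
  split_ifs
  · exact hasSum_jacobiAnger _ ψ
  · simp

/-- The contribution of an antenna pair with differences `z₁`, `z₂` to `|aᴴ(φ, θ) a(φ', θ')|²`,
restricted to elevations in `[0, π]` modulo `2π`. The first ray enters conjugated, hence `-zT`. -/
noncomputable def pairWave (z₁ z₂ φ θ φ' θ' : ℝ) : ℂ :=
  windowWave (-zT z₁ z₂ : ℝ) (φ + phaseAngle z₁ z₂) θ *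
    windowWave (zT z₁ z₂) (φ' + phaseAngle z₁ z₂) θ'

/-- A summable bound for the terms of the windowed Jacobi-Anger series. -/
noncomputable def waveBound (R : ℝ) (n : ℤ) : ℝ :=
  (R / 2) ^ n.natAbs / n.natAbs.factorial * Real.exp ((R / 2) ^ 2)

theorem summable_waveBound (R : ℝ) : Summable (waveBound R) := by
  have h : Summable fun n : ℕ => (R / 2) ^ n / n.factorial * Real.exp ((R / 2) ^ 2) :=
    (Real.summable_pow_div_factorial _).mul_right _
  refine Summable.of_nat_of_neg ?_ ?_ <;> simpa [waveBound] using h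

theorem norm_windowWave_term_le (r : ℂ) (n : ℤ) (ψ θ : ℝ) :
    ‖(-1) ^ (min n 0) * besselWindow n r θ * Complex.exp (Complex.I * (n * ψ))‖ ≤
      waveBound ‖r‖ n := by
  rw [norm_mul, norm_mul, norm_exp_I_mul_int, norm_zpow, norm_neg, norm_one, one_zpow, one_mul,
    mul_one]
  exact norm_besselWindow_le n r θ

theorem waveBound_nonneg {R : ℝ} (hR : 0 ≤ R) (n : ℤ) : 0 ≤ waveBound R n := by
  unfold waveBound; positivity

/-- The azimuth factor of the term of index `(n, n')`, with the signs of the Bessel functions of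
negative order. -/
noncomputable def azimuthPhase (n n' : ℤ) (ψ₁ ψ₂ : ℝ) : ℂ :=
  ((-1) ^ (min n 0) * Complex.exp (Complex.I * (n * ψ₁))) *
    ((-1) ^ (min n' 0) * Complex.exp (Complex.I * (n' * ψ₂)))

theorem norm_azimuthPhase (n n' : ℤ) (ψ₁ ψ₂ : ℝ) : ‖azimuthPhase n n' ψ₁ ψ₂‖ = 1 := by
  simp only [azimuthPhase, norm_mul, norm_exp_I_mul_int, norm_zpow, norm_neg, norm_one, one_zpow,
    mul_one]

theorem measurable_azimuthPhase {Ω : Type*} [MeasurableSpace Ω] (n n' : ℤ) {ψ₁ ψ₂ : Ω → ℝ}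
    (h₁ : Measurable ψ₁) (h₂ : Measurable ψ₂) :
    Measurable fun ω => azimuthPhase n n' (ψ₁ ω) (ψ₂ ω) := by
  unfold azimuthPhase
  fun_prop

theorem azimuthPhase_add (n n' : ℤ) (ψ₁ ψ₂ α : ℝ) :
    azimuthPhase n n' (ψ₁ + α) (ψ₂ + α) =
      (-1) ^ (min n 0 + min n' 0) * Complex.exp (Complex.I * ((n + n') * α)) *
        (Complex.exp (Complex.I * (n * ψ₁)) * Complex.exp (Complex.I * (n' * ψ₂))) := by
  have e1 : Complex.exp (Complex.I * (n * (ψ₁ + α : ℝ))) =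
      Complex.exp (Complex.I * (n * α)) * Complex.exp (Complex.I * (n * ψ₁)) := by
    rw [← Complex.exp_add]; congr 1; push_cast; ring
  have e2 : Complex.exp (Complex.I * (n' * (ψ₂ + α : ℝ))) =
      Complex.exp (Complex.I * (n' * α)) * Complex.exp (Complex.I * (n' * ψ₂)) := by
    rw [← Complex.exp_add]; congr 1; push_cast; ring
  have e3 : Complex.exp (Complex.I * (((n : ℂ) + n') * α)) =
      Complex.exp (Complex.I * (n * α)) * Complex.exp (Complex.I * (n' * α)) := by
    rw [← Complex.exp_add]; congr 1; ring
  rw [azimuthPhase, e1, e2, e3, zpow_add₀ (by norm_num)]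
  ring

theorem zetaS_eq_circleCoeff (n n' k k' : ℤ) (z : ℝ) :
    zetaS n n' k k' z = 4 * ((-1) ^ (min n 0 + min n' 0) *
      (circleCoeff (besselWindow n (-z : ℝ)) k * circleCoeff (besselWindow n' z) k')) := by
  have e4 : Complex.exp (-(Complex.I * (Real.pi / 2) * ((k : ℂ) + k'))) =
      Complex.exp (-(Complex.I * (Real.pi / 2) * k)) *
        Complex.exp (-(Complex.I * (Real.pi / 2) * k')) := by
    rw [← Complex.exp_add]; congr 1; ring
  have e5 : ((-z : ℝ) : ℂ) / 2 = -((z : ℂ) / 2) := by push_cast; ring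
  rw [circleCoeff_besselWindow, circleCoeff_besselWindow, zetaS, e4, e5]
  ring

section Series

variable {Ω : Type*} [MeasurableSpace Ω]

/-- By independence, each term of the fourfold series is a single expectation over both rays. -/
theorem ksTerm_eq_integral {P : Measure Ω} {φc θc Δ₁ Δ₂ δ₁ δ₂ : Ω → ℝ}
    (hφc : Measurable φc) (hθc : Measurable θc)
    (hΔ₁ : Measurable Δ₁) (hΔ₂ : Measurable Δ₂) (hδ₁ : Measurable δ₁) (hδ₂ : Measurable δ₂)
    (hindep : iIndepFun ![φc, θc, Δ₁, Δ₂, δ₁, δ₂] P)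
    (hΔ : IdentDistrib Δ₁ Δ₂ P P) (hδ : IdentDistrib δ₁ δ₂ P P) (z₁ z₂ : ℝ) (n n' k k' : ℤ) :
    ksTerm P φc θc Δ₁ δ₁ z₁ z₂ n n' k k' =
      4 * ∫ ω, azimuthPhase n n' (φc ω + Δ₁ ω + phaseAngle z₁ z₂)
          (φc ω + Δ₂ ω + phaseAngle z₁ z₂) *
        (circleCoeff (besselWindow n (-zT z₁ z₂ : ℝ)) k *
          Complex.exp (Complex.I * (k * (θc ω + δ₁ ω : ℝ)))) *
        (circleCoeff (besselWindow n' (zT z₁ z₂)) k' *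
          Complex.exp (Complex.I * (k' * (θc ω + δ₂ ω : ℝ)))) ∂P := by
  have hI := integral_exp_angles hφc hθc hΔ₁ hΔ₂ hδ₁ hδ₂ hindep n n' k k'
  rw [← angleChar_congr hΔ, ← angleChar_congr hδ] at hI
  rw [ksTerm, zetaS_eq_circleCoeff, ← hI]
  generalize circleCoeff (besselWindow n (-zT z₁ z₂ : ℝ)) k = A
  generalize circleCoeff (besselWindow n' (zT z₁ z₂)) k' = A'
  have e : ∀ ω, azimuthPhase n n' (φc ω + Δ₁ ω + phaseAngle z₁ z₂)
          (φc ω + Δ₂ ω + phaseAngle z₁ z₂) *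
        (A * Complex.exp (Complex.I * (k * (θc ω + δ₁ ω : ℝ)))) *
        (A' * Complex.exp (Complex.I * (k' * (θc ω + δ₂ ω : ℝ)))) =
      ((-1) ^ (min n 0 + min n' 0) * Complex.exp (Complex.I * ((n + n') * phaseAngle z₁ z₂)) *
        A * A') *
      (Complex.exp (Complex.I * (n * (φc ω + Δ₁ ω : ℝ))) *
        Complex.exp (Complex.I * (n' * (φc ω + Δ₂ ω : ℝ))) *
        Complex.exp (Complex.I * (k * (θc ω + δ₁ ω : ℝ))) *
        Complex.exp (Complex.I * (k' * (θc ω + δ₂ ω : ℝ)))) := by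
    intro ω
    rw [azimuthPhase_add]
    ring
  rw [integral_congr_ae (Filter.Eventually.of_forall e), integral_const_mul]
  ring

/-- The sum over the orders `(n, n')` of the windowed Jacobi-Anger expansions of both rays, taken
inside the expectation. -/
theorem hasSum_integral_windowWave {P : Measure Ω} [IsProbabilityMeasure P] {ψ₁ ψ₂ θ₁ θ₂ : Ω → ℝ}
    (hψ₁ : Measurable ψ₁) (hψ₂ : Measurable ψ₂) (hθ₁ : Measurable θ₁) (hθ₂ : Measurable θ₂)
    (r r' : ℂ) :
    HasSum (fun q : ℤ × ℤ => ∫ ω, azimuthPhase q.1 q.2 (ψ₁ ω) (ψ₂ ω) *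
        besselWindow q.2 r' (θ₂ ω) * besselWindow q.1 r (θ₁ ω) ∂P)
      (∫ ω, windowWave r (ψ₁ ω) (θ₁ ω) * windowWave r' (ψ₂ ω) (θ₂ ω) ∂P) := by
  have hs : Summable fun q : ℤ × ℤ => waveBound ‖r‖ q.1 * waveBound ‖r'‖ q.2 :=
    (summable_waveBound _).mul_of_nonneg (summable_waveBound _)
      (waveBound_nonneg (norm_nonneg _)) (waveBound_nonneg (norm_nonneg _))
  have hfac : ∀ (q : ℤ × ℤ) ω, azimuthPhase q.1 q.2 (ψ₁ ω) (ψ₂ ω) *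
        besselWindow q.2 r' (θ₂ ω) * besselWindow q.1 r (θ₁ ω) =
      ((-1) ^ (min q.1 0) * besselWindow q.1 r (θ₁ ω) *
        Complex.exp (Complex.I * (q.1 * ψ₁ ω))) *
      ((-1) ^ (min q.2 0) * besselWindow q.2 r' (θ₂ ω) *
        Complex.exp (Complex.I * (q.2 * ψ₂ ω))) := by
    intro q ω
    rw [azimuthPhase]
    ring
  have hbound : ∀ (q : ℤ × ℤ) ω, ‖((-1) ^ (min q.1 0) * besselWindow q.1 r (θ₁ ω) *
        Complex.exp (Complex.I * (q.1 * ψ₁ ω))) *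
      ((-1) ^ (min q.2 0) * besselWindow q.2 r' (θ₂ ω) *
        Complex.exp (Complex.I * (q.2 * ψ₂ ω)))‖ ≤ waveBound ‖r‖ q.1 * waveBound ‖r'‖ q.2 := by
    intro q ω
    rw [norm_mul]
    exact mul_le_mul (norm_windowWave_term_le _ _ _ _) (norm_windowWave_term_le _ _ _ _)
      (norm_nonneg _) (waveBound_nonneg (norm_nonneg _) _)
  refine hasSum_integral_of_dominated_convergence
    (fun q _ => waveBound ‖r‖ q.1 * waveBound ‖r'‖ q.2) (fun q => ?_)
    (fun q => Filter.Eventually.of_forall fun ω => ?_) (Filter.Eventually.of_forall fun _ => hs)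
    (integrable_const _) (Filter.Eventually.of_forall fun ω => ?_)
  · exact (((measurable_azimuthPhase _ _ hψ₁ hψ₂).mul
      ((measurable_besselWindow _ _).comp hθ₂)).mul
      ((measurable_besselWindow _ _).comp hθ₁)).aestronglyMeasurable
  · rw [hfac]
    exact hbound q ω
  · have h1 := hasSum_windowWave r (ψ₁ ω) (θ₁ ω)
    have h2 := hasSum_windowWave r' (ψ₂ ω) (θ₂ ω)
    have h3 := h1.mul h2 (Summable.of_norm_bounded hs fun q => hbound q ω)
    exact hasSum_of_forall_eq (fun q => hfac q ω) h3

/-- The fourfold series of one antenna pair sums to four times the windowed expectation of its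
plane wave. -/
theorem hasFourfoldSum_ksTerm {P : Measure Ω}
    [IsProbabilityMeasure P] {φc θc Δ₁ Δ₂ δ₁ δ₂ : Ω → ℝ}
    (hφc : Measurable φc) (hθc : Measurable θc)
    (hΔ₁ : Measurable Δ₁) (hΔ₂ : Measurable Δ₂) (hδ₁ : Measurable δ₁) (hδ₂ : Measurable δ₂)
    (hindep : iIndepFun ![φc, θc, Δ₁, Δ₂, δ₁, δ₂] P)
    (hΔ : IdentDistrib Δ₁ Δ₂ P P) (hδ : IdentDistrib δ₁ δ₂ P P)
    (hpdf : P.map δ₁ ≪ volume) (z₁ z₂ : ℝ) :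
    HasFourfoldSum (ksTerm P φc θc Δ₁ δ₁ z₁ z₂)
      (4 * ∫ ω, pairWave z₁ z₂ (φc ω + Δ₁ ω) (θc ω + δ₁ ω) (φc ω + Δ₂ ω) (θc ω + δ₂ ω) ∂P) := by
  have hterm := ksTerm_eq_integral hφc hθc hΔ₁ hΔ₂ hδ₁ hδ₂ hindep hΔ hδ z₁ z₂
  have hsin1 : ∀ᵐ ω ∂P, Real.sin (θc ω + δ₁ ω) ≠ 0 :=
    ae_sin_add_ne_zero hθc hδ₁ (hindep.indepFun (i := 1) (j := 4) (by decide)) hpdf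
  have hsin2 : ∀ᵐ ω ∂P, Real.sin (θc ω + δ₂ ω) ≠ 0 :=
    ae_sin_add_ne_zero hθc hδ₂ (hindep.indepFun (i := 1) (j := 5) (by decide))
      (hδ.map_eq ▸ hpdf)
  have hm1 : Measurable fun ω => φc ω + Δ₁ ω + phaseAngle z₁ z₂ := by fun_prop
  have hm2 : Measurable fun ω => φc ω + Δ₂ ω + phaseAngle z₁ z₂ := by fun_prop
  have ht1 : Measurable fun ω => θc ω + δ₁ ω := by fun_prop
  have ht2 : Measurable fun ω => θc ω + δ₂ ω := by fun_prop
  have hV := fun n n' => measurable_azimuthPhase n n' hm1 hm2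
  have hsum := hasSum_integral_windowWave (P := P) hm1 hm2 ht1 ht2 (-zT z₁ z₂ : ℝ) (zT z₁ z₂)
  refine ⟨fun n n' => 4 * ∫ ω, azimuthPhase n n' (φc ω + Δ₁ ω + phaseAngle z₁ z₂)
          (φc ω + Δ₂ ω + phaseAngle z₁ z₂) * besselWindow n' (zT z₁ z₂) (θc ω + δ₂ ω) *
        besselWindow n (-zT z₁ z₂ : ℝ) (θc ω + δ₁ ω) ∂P,
    fun n n' k => 4 * ∫ ω, azimuthPhase n n' (φc ω + Δ₁ ω + phaseAngle z₁ z₂)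
          (φc ω + Δ₂ ω + phaseAngle z₁ z₂) *
        (circleCoeff (besselWindow n (-zT z₁ z₂ : ℝ)) k *
          Complex.exp (Complex.I * (k * (θc ω + δ₁ ω : ℝ)))) *
        besselWindow n' (zT z₁ z₂) (θc ω + δ₂ ω) ∂P,
    fun n n' k => ?_, fun n n' => ?_, hsum.mul_left 4⟩
  · refine hasSum_of_forall_eq (hterm n n' k) (HasSum.mul_left _ ?_)
    refine hasSum_integral_besselWindow
      (B := ‖circleCoeff (besselWindow n (-zT z₁ z₂ : ℝ)) k‖) ?_ (fun ω => ?_) ht2 hsin2 n' _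
    · exact (hV n n').fun_mul (by fun_prop)
    · rw [norm_mul, norm_mul, norm_exp_I_mul_int, mul_one, norm_azimuthPhase, one_mul]
  · have hb := hasSum_integral_besselWindow (P := P)
      (U := fun ω => azimuthPhase n n' (φc ω + Δ₁ ω + phaseAngle z₁ z₂)
          (φc ω + Δ₂ ω + phaseAngle z₁ z₂) * besselWindow n' (zT z₁ z₂) (θc ω + δ₂ ω))
      (B := waveBound ‖(zT z₁ z₂ : ℂ)‖ n')
      ((hV n n').fun_mul ((measurable_besselWindow n' _).comp ht2)) (fun ω => by
        rw [norm_mul, norm_azimuthPhase, one_mul]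
        exact norm_besselWindow_le n' _ _) ht1 hsin1 n (-zT z₁ z₂ : ℝ)
    refine hasSum_of_forall_eq (fun k => ?_) (hb.mul_left 4)
    refine congrArg (fun c : ℂ => 4 * c)
      (integral_congr_ae (Filter.Eventually.of_forall fun ω => ?_))
    exact mul_right_comm _ _ _

end Series

/-! ### The array correlation as a sum of plane waves -/

theorem mem_elevationWindow_iff (x : ℝ) : x ∈ elevationWindow ↔ 0 ≤ Real.sin x := by
  have hpi := Real.pi_pos
  have hper : ∀ j : ℤ, Real.sin (x - 2 * Real.pi * j) = Real.sin x := fun j => by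
    rw [mul_comm, Real.sin_sub_int_mul_two_pi]
  constructor
  · rintro ⟨j, hj⟩
    rw [← hper j]
    exact Real.sin_nonneg_of_mem_Icc hj
  · intro h
    refine ⟨⌊x / (2 * Real.pi)⌋, ?_, ?_⟩
    · have := Int.floor_le (x / (2 * Real.pi))
      rw [le_div_iff₀ (by positivity)] at this
      linarith
    · by_contra! hlt
      have h1 := Int.lt_floor_add_one (x / (2 * Real.pi))
      rw [div_lt_iff₀ (by positivity)] at h1
      have h2 := Real.sin_neg_of_neg_of_neg_pi_lt
        (x := x - 2 * Real.pi * ⌊x / (2 * Real.pi)⌋ - 2 * Real.pi) (by linarith) (by linarith)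
      rw [Real.sin_sub_two_pi, hper] at h2
      exact absurd h (not_le.2 h2)

theorem measurableSet_elevationWindow : MeasurableSet elevationWindow := by
  have : elevationWindow = {x | 0 ≤ Real.sin x} := Set.ext mem_elevationWindow_iff
  rw [this]
  exact measurableSet_le measurable_const Real.measurable_sin

/-- The product of the entries of index `p` and `q` of `aᴴ a'` depends on the antenna differences
only: it is the plane wave of the pair for both rays. -/
theorem steer_mul_conj {Mx My : ℕ} (dx dy φ φ' : ℝ) {θ θ' : ℝ} (hθ : 0 ≤ Real.sin θ)
    (hθ' : 0 ≤ Real.sin θ') (mx mx' : Fin Mx) (my my' : Fin My) :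
    star (steer Mx My dx dy φ θ (mx, my)) * steer Mx My dx dy φ' θ' (mx, my) *
      star (star (steer Mx My dx dy φ θ (mx', my')) * steer Mx My dx dy φ' θ' (mx', my')) =
    pairWave (dx * (((mx : ℕ) : ℝ) - ((mx' : ℕ) : ℝ))) (dy * (((my : ℕ) : ℝ) - ((my' : ℕ) : ℝ)))
      φ θ φ' θ' := by
  rw [pairWave, windowWave, windowWave, sineWindow, sineWindow, if_pos hθ, if_pos hθ']
  set z₁ := dx * (((mx : ℕ) : ℝ) - ((mx' : ℕ) : ℝ)) with hz₁
  set z₂ := dy * (((my : ℕ) : ℝ) - ((my' : ℕ) : ℝ)) with hz₂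
  have hw : ∀ φ θ : ℝ, (zT z₁ z₂ : ℂ) * Real.sin θ * Real.sin (φ + phaseAngle z₁ z₂) =
      2 * Real.pi * (z₁ * Real.cos φ + z₂ * Real.sin φ) * Real.sin θ := by
    intro φ θ
    have h := congrArg (fun t : ℝ => (t : ℂ)) (zT_mul_sin_add_phaseAngle z₁ z₂ φ)
    push_cast at h ⊢
    linear_combination Complex.sin θ * h
  have hneg : ∀ φ θ : ℝ, ((-zT z₁ z₂ : ℝ) : ℂ) * Real.sin θ * Real.sin (φ + phaseAngle z₁ z₂) =
      -(2 * Real.pi * (z₁ * Real.cos φ + z₂ * Real.sin φ) * Real.sin θ) := by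
    intro φ θ
    rw [← hw]
    push_cast
    ring
  have hsteer : ∀ (φ θ : ℝ) (m : Fin Mx) (m' : Fin My), steer Mx My dx dy φ θ (m, m') =
      Complex.exp (Complex.I * ((2 * Real.pi * (dx * (m : ℕ) * Real.cos φ +
        dy * (m' : ℕ) * Real.sin φ) * Real.sin θ : ℝ) : ℂ)) := by
    intro φ θ m m'
    rw [steer, steerX, steerY, ← Complex.exp_add]
    congr 1
    push_cast
    ring
  have hstar : ∀ x : ℝ, star (Complex.exp (Complex.I * x)) = Complex.exp (-(Complex.I * x)) := by
    intro x
    rw [Complex.star_def, ← Complex.exp_conj, map_mul, Complex.conj_I, Complex.conj_ofReal, neg_mul]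
  rw [hw, hneg, hsteer, hsteer, hsteer, hsteer, star_mul', star_star, hstar, hstar,
    ← Complex.exp_add, ← Complex.exp_add, ← Complex.exp_add, ← Complex.exp_add, hz₁, hz₂]
  congr 1
  push_cast
  ring

theorem rayCorr_eq_sum (Mx My : ℕ) (dx dy φ θ φ' θ' : ℝ) :
    (rayCorr Mx My dx dy φ θ φ' θ' : ℂ) =
      ∑ mx : Fin Mx, ∑ mx' : Fin Mx, ∑ my : Fin My, ∑ my' : Fin My,
        star (steer Mx My dx dy φ θ (mx, my)) * steer Mx My dx dy φ' θ' (mx, my) *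
        star (star (steer Mx My dx dy φ θ (mx', my')) * steer Mx My dx dy φ' θ' (mx', my')) := by
  rw [rayCorr]
  push_cast
  rw [← Complex.mul_conj', ← Complex.star_def, dotProduct, star_sum, Finset.sum_mul_sum,
    Fintype.sum_prod_type]
  refine Finset.sum_congr rfl fun mx _ => ?_
  simp only [Fintype.sum_prod_type]
  rw [Finset.sum_comm]
  rfl

theorem indicator_rayCorr (Mx My : ℕ) (dx dy φ θ φ' θ' : ℝ) :
    (elevationWindow ×ˢ elevationWindow).indicator
      (fun t => (rayCorr Mx My dx dy φ t.1 φ' t.2 : ℂ)) (θ, θ') =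
      ∑ mx : Fin Mx, ∑ mx' : Fin Mx, ∑ my : Fin My, ∑ my' : Fin My,
        pairWave (dx * (((mx : ℕ) : ℝ) - ((mx' : ℕ) : ℝ)))
          (dy * (((my : ℕ) : ℝ) - ((my' : ℕ) : ℝ))) φ θ φ' θ' := by
  by_cases h : 0 ≤ Real.sin θ ∧ 0 ≤ Real.sin θ'
  · rw [Set.indicator_of_mem (Set.mk_mem_prod ((mem_elevationWindow_iff _).2 h.1)
      ((mem_elevationWindow_iff _).2 h.2)), rayCorr_eq_sum]
    simp only [steer_mul_conj _ _ _ _ h.1 h.2]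
  · rw [Set.indicator_of_notMem fun hm => h ⟨(mem_elevationWindow_iff _).1 hm.1,
      (mem_elevationWindow_iff _).1 hm.2⟩]
    symm
    refine Finset.sum_eq_zero fun mx _ => Finset.sum_eq_zero fun mx' _ =>
      Finset.sum_eq_zero fun my _ => Finset.sum_eq_zero fun my' _ => ?_
    rw [not_and_or] at h
    rcases h with h | h <;> simp [pairWave, windowWave, sineWindow, h]

theorem KsWindow_eq_sum {Ω : Type*} [MeasurableSpace Ω] {P : Measure Ω} [IsProbabilityMeasure P]
    (Mx My : ℕ) (dx dy : ℝ) {φc θc Δ₁ Δ₂ δ₁ δ₂ : Ω → ℝ}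
    (hφc : Measurable φc) (hθc : Measurable θc)
    (hΔ₁ : Measurable Δ₁) (hΔ₂ : Measurable Δ₂) (hδ₁ : Measurable δ₁) (hδ₂ : Measurable δ₂) :
    (KsWindow P Mx My dx dy φc θc Δ₁ Δ₂ δ₁ δ₂ : ℂ) = 1 / ((Mx : ℂ) * My) ^ 2 *
      ∑ mx : Fin Mx, ∑ mx' : Fin Mx, ∑ my : Fin My, ∑ my' : Fin My,
        ∫ ω, pairWave (dx * (((mx : ℕ) : ℝ) - ((mx' : ℕ) : ℝ)))
          (dy * (((my : ℕ) : ℝ) - ((my' : ℕ) : ℝ)))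
          (φc ω + Δ₁ ω) (θc ω + δ₁ ω) (φc ω + Δ₂ ω) (θc ω + δ₂ ω) ∂P := by
  have hS : MeasurableSet {ω | θc ω + δ₁ ω ∈ elevationWindow ∧ θc ω + δ₂ ω ∈ elevationWindow} :=
    (measurableSet_elevationWindow.preimage (hθc.add hδ₁)).inter
      (measurableSet_elevationWindow.preimage (hθc.add hδ₂))
  have hint : ∀ z₁ z₂ : ℝ, Integrable (fun ω =>
      pairWave z₁ z₂ (φc ω + Δ₁ ω) (θc ω + δ₁ ω) (φc ω + Δ₂ ω) (θc ω + δ₂ ω)) P := by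
    intro z₁ z₂
    refine Integrable.of_bound (C := 1 * 1) (Measurable.aestronglyMeasurable
      ((measurable_windowWave _ (by fun_prop) (by fun_prop)).fun_mul
        (measurable_windowWave _ (by fun_prop) (by fun_prop))))
      (Filter.Eventually.of_forall fun ω => ?_)
    rw [pairWave, norm_mul]
    exact mul_le_mul (norm_windowWave_le _ _ _) (norm_windowWave_le _ _ _) (norm_nonneg _)
      zero_le_one
  have hpt : ∀ ω, Set.indicator
      {ω | θc ω + δ₁ ω ∈ elevationWindow ∧ θc ω + δ₂ ω ∈ elevationWindow}
      (fun ω => (rayCorr Mx My dx dy (φc ω + Δ₁ ω) (θc ω + δ₁ ω) (φc ω + Δ₂ ω) (θc ω + δ₂ ω) : ℂ))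
      ω = _ := fun ω =>
    indicator_rayCorr Mx My dx dy (φc ω + Δ₁ ω) (θc ω + δ₁ ω) (φc ω + Δ₂ ω) (θc ω + δ₂ ω)
  have hM : ((1 / ((Mx : ℝ) * My) ^ 2 : ℝ) : ℂ) = 1 / ((Mx : ℂ) * My) ^ 2 := by push_cast; rfl
  rw [KsWindow, Complex.ofReal_mul, hM, ← integral_complex_ofReal, ← integral_indicator hS,
    integral_congr_ae (Filter.Eventually.of_forall hpt)]
  congr 1
  rw [integral_finsetSum _ fun mx _ => integrable_finsetSum _ fun mx' _ =>
    integrable_finsetSum _ fun my _ => integrable_finsetSum _ fun my' _ => hint _ _]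
  refine Finset.sum_congr rfl fun mx _ => ?_
  rw [integral_finsetSum _ fun mx' _ =>
    integrable_finsetSum _ fun my _ => integrable_finsetSum _ fun my' _ => hint _ _]
  refine Finset.sum_congr rfl fun mx' _ => ?_
  rw [integral_finsetSum _ fun my _ => integrable_finsetSum _ fun my' _ => hint _ _]
  refine Finset.sum_congr rfl fun my _ => ?_
  rw [integral_finsetSum _ fun my' _ => hint _ _]

theorem Ks_eq_KsWindow {Ω : Type*} [MeasurableSpace Ω] {P : Measure Ω} (Mx My : ℕ) (dx dy : ℝ)
    (φc θc Δ₁ Δ₂ δ₁ δ₂ : Ω → ℝ)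
    (h : ∀ᵐ ω ∂P, θc ω + δ₁ ω ∈ Set.Icc 0 Real.pi ∧ θc ω + δ₂ ω ∈ Set.Icc 0 Real.pi) :
    Ks P Mx My dx dy φc θc Δ₁ Δ₂ δ₁ δ₂ = KsWindow P Mx My dx dy φc θc Δ₁ Δ₂ δ₁ δ₂ := by
  rw [Ks, KsWindow, Measure.restrict_eq_self_of_ae_mem]
  filter_upwards [h] with ω hω
  exact ⟨⟨0, by simpa using hω.1⟩, ⟨0, by simpa using hω.2⟩⟩

theorem lemma1 {Ω : Type*} [MeasurableSpace Ω] (P : Measure Ω) [IsProbabilityMeasure P]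
    (Mx My : ℕ) (dx dy : ℝ) (φc θc Δ₁ Δ₂ δ₁ δ₂ : Ω → ℝ)
    (hφc : Measurable φc) (hθc : Measurable θc)
    (hΔ₁ : Measurable Δ₁) (hΔ₂ : Measurable Δ₂) (hδ₁ : Measurable δ₁) (hδ₂ : Measurable δ₂)
    (hindep : iIndepFun ![φc, θc, Δ₁, Δ₂, δ₁, δ₂] P)
    (hΔ : IdentDistrib Δ₁ Δ₂ P P) (hδ : IdentDistrib δ₁ δ₂ P P)
    (hpdf : P.map δ₁ ≪ volume) :
    ∃ s : Fin Mx → Fin Mx → Fin My → Fin My → ℂ,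
      (∀ (mx mx' : Fin Mx) (my my' : Fin My),
        HasFourfoldSum
          (ksTerm P φc θc Δ₁ δ₁
            (dx * (((mx : ℕ) : ℝ) - ((mx' : ℕ) : ℝ))) (dy * (((my : ℕ) : ℝ) - ((my' : ℕ) : ℝ))))
          (s mx mx' my my')) ∧
      (KsWindow P Mx My dx dy φc θc Δ₁ Δ₂ δ₁ δ₂ : ℂ) =
        1 / (4 * ((Mx : ℂ) * My) ^ 2) * ∑ mx, ∑ mx', ∑ my, ∑ my', s mx mx' my my' ∧
      ((∀ᵐ ω ∂P, θc ω + δ₁ ω ∈ Set.Icc 0 Real.pi ∧ θc ω + δ₂ ω ∈ Set.Icc 0 Real.pi) →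
        (Ks P Mx My dx dy φc θc Δ₁ Δ₂ δ₁ δ₂ : ℂ) =
          1 / (4 * ((Mx : ℂ) * My) ^ 2) * ∑ mx, ∑ mx', ∑ my, ∑ my', s mx mx' my my') := by
  have hK := KsWindow_eq_sum (P := P) Mx My dx dy hφc hθc hΔ₁ hΔ₂ hδ₁ hδ₂
  have hmain := hK.trans (show _ = 1 / (4 * ((Mx : ℂ) * My) ^ 2) *
      ∑ mx : Fin Mx, ∑ mx' : Fin Mx, ∑ my : Fin My, ∑ my' : Fin My, 4 *
        ∫ ω, pairWave (dx * (((mx : ℕ) : ℝ) - ((mx' : ℕ) : ℝ)))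
          (dy * (((my : ℕ) : ℝ) - ((my' : ℕ) : ℝ)))
          (φc ω + Δ₁ ω) (θc ω + δ₁ ω) (φc ω + Δ₂ ω) (θc ω + δ₂ ω) ∂P by
    simp only [← Finset.mul_sum]
    rw [one_div, one_div, mul_inv]
    ring)
  refine ⟨fun mx mx' my my' => 4 *
        ∫ ω, pairWave (dx * (((mx : ℕ) : ℝ) - ((mx' : ℕ) : ℝ)))
          (dy * (((my : ℕ) : ℝ) - ((my' : ℕ) : ℝ)))
          (φc ω + Δ₁ ω) (θc ω + δ₁ ω) (φc ω + Δ₂ ω) (θc ω + δ₂ ω) ∂P,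
    fun mx mx' my my' => hasFourfoldSum_ksTerm hφc hθc hΔ₁ hΔ₂ hδ₁ hδ₂ hindep hΔ hδ hpdf _ _,
    hmain, fun h => ?_⟩
  rw [Ks_eq_KsWindow Mx My dx dy φc θc Δ₁ Δ₂ δ₁ δ₂ h]
  exact hmain
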